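/- Let $L/K$ be a finite (not necessarily Galois) extension of number fields with normal closure $E/K$. Put $G=\mathrm{Gal}(E/K)$, $G'=\mathrm{Gal}(E/L)$, let $X=G/G'$ be the set of left cosets, and let $\lambda:G\to\mathrm{Perm}(X)$, $\lambda(g)(xG')=gxG'$. Let $N\le \mathrm{Perm}(X)$ be a regular subgroup (that is, $N$ is transitive on $X$ and $|N|=|X|$) normalised by $\lambda(G)$. Let $G$ act on $E[N]$ through the Galois action on coefficients and through $n\mapsto\lambda(g)n\lambda(g)^{-1}$ on $N$, and let $H=E[N]^G$, acting on $L$ by $$\Big(\sum_{n\in N}c_n n\Big)\cdot x=\sum_{n\in N}c_n\,\big(n^{-1}(\overline{1})\big)(x),$$ where a coset $gG'$ is applied to $x\in L$ as $g(x)$. (By the theorem of Greither and Pareigis these are exactly the Hopf–Galois structures on $L/K$.) Suppose that $H$ is commutative. Let $\mathfrak A_H=\{h\in H: h\cdot x\in\mathfrak O_L\text{ for all }x\in\mathfrak O_L\}$ be the associated order. Let $\mathfrak p$ be a nonzero prime of $\mathfrak O_K$ lying above a prime number $p$ with $p\nmid[L:K]$. Write $A_{\mathfrak p}=K_{\mathfrak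 p}\otimes_K A$ for a $K$-algebra $A$, where $K_{\mathfrak p}$ is the completion, with valuation ring $\mathfrak O_{K,\mathfrak p}$, and write $\Lambda_{\mathfrak p}=\mathfrak O_{K,\mathfrak p}\otimes_{\mathfrak O_K}\Lambda\subseteq A_{\mathfrak p}$ for an $\mathfrak O_K$-order $\Lambda$ in $A$. Let $\mathfrak A_{H,\mathfrak p}=(\mathfrak A_H)_{\mathfrak p}\subseteq H_{\mathfrak p}$, $\mathfrak O_{L,\mathfrak p}=(\mathfrak O_L)_{\mathfrak p}\subseteq L_{\mathfrak p}$, $\mathfrak O_{E,\mathfrak p}=(\mathfrak O_E)_{\mathfrak p}\subseteq E_{\mathfrak p}$, and let $G$ act on $E_{\mathfrak p}[N]$ through its action on the factor $E$ of the coefficients and by conjugation via $\lambda$ on $N$. Then: 1. under the canonical embedding $H_{\mathfrak p}\to E_{\mathfrak p}[N]$, one has $\mathfrak A_{H,\mathfrak p}=\mathfrak O_{E,\mathfrak p}[N]^G$; 2. $\mathfrak A_{H,\mathfrak p}$ is the unique maximal $\mathfrak O_{K,\mathfrak p}$-order in $H_{\mathfrak p}$; 3. $\mathfrak O_{L,\mathfrak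 p}$ is a free $\mathfrak A_{H,\mathfrak p}$-module. -/

import Mathlib

open scoped NumberField TensorProduct
open IsDedekindDomain

noncomputable section

namespace HopfGalois

section Orders

lemma commute_ofId {F B : Type*} [CommSemiring F] [Semiring B] [Algebra F B] (a : F) (b : B) :
    Commute (Algebra.ofId F B a) b :=
  Algebra.commutes a b

/-- An `R`-order in an `F`-algebra `A` (`F` the fraction field of `R`): a subring containing `R`
which is finitely generated as an `R`-module and spans `A` over `F`. -/
def IsOrder {R : Type*} (F : Type*) {A : Type*} [CommRing R] [Field F] [Ring A] [Algebra R A]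
    [Algebra F A] (Λ : Subalgebra R A) : Prop :=
  (Subalgebra.toSubmodule Λ).FG ∧ Submodule.span F (Λ : Set A) = ⊤

/-- `M` is the unique maximal `R`-order in the `F`-algebra `A`. -/
def IsUniqueMaximalOrder {R : Type*} (F : Type*) {A : Type*} [CommRing R] [Field F] [Ring A]
    [Algebra R A] [Algebra F A] (M : Subalgebra R A) : Prop :=
  ∀ Λ : Subalgebra R A, Maximal (IsOrder F) Λ ↔ Λ = M

variable {K : Type*} [Field K] [NumberField K] (v : HeightOneSpectrum (𝓞 K))

/-- The completed lattice `M_𝔭`: the image of `𝓞_{K,𝔭} ⊗ M` in `V_𝔭 = K_𝔭 ⊗_K V`, where `M` is an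
`𝓞_K`-submodule of the `K`-vector space `V`. -/
def completedLattice {V : Type*} [AddCommGroup V] [Module K V] [Module (𝓞 K) V]
    (M : Submodule (𝓞 K) V) :
    Submodule (v.adicCompletionIntegers K) (v.adicCompletion K ⊗[K] V) :=
  Submodule.span (v.adicCompletionIntegers K) {z | ∃ m ∈ M, z = 1 ⊗ₜ[K] m}

/-- The completed order `Λ_𝔭` in `A_𝔭 = K_𝔭 ⊗_K A`, where `Λ` is an `𝓞_K`-subalgebra of `A`. -/
def completedOrder {A : Type*} [Ring A] [Algebra K A] [Algebra (𝓞 K) A]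
    (Λ : Subalgebra (𝓞 K) A) :
    Subalgebra (v.adicCompletionIntegers K) (v.adicCompletion K ⊗[K] A) :=
  (completedLattice v (Subalgebra.toSubmodule Λ)).toSubalgebra
    (Submodule.subset_span ⟨1, Λ.one_mem, rfl⟩)
    (by
      intro x y hx hy
      induction hx, hy using Submodule.span_induction₂ with
      | mem_mem x y hx hy =>
        obtain ⟨a, ha, rfl⟩ := hx
        obtain ⟨b, hb, rfl⟩ := hy
        exact Submodule.subset_span ⟨a * b, Λ.mul_mem ha hb, by simp⟩
      | zero_left y hy => simp
      | zero_right x hx => simp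
      | add_left x y z hx hy hz h1 h2 => rw [add_mul]; exact Submodule.add_mem _ h1 h2
      | add_right x y z hx hy hz h1 h2 => rw [mul_add]; exact Submodule.add_mem _ h1 h2
      | smul_left r x y hx hy h => rw [smul_mul_assoc]; exact Submodule.smul_mem _ _ h
      | smul_right r x y hx hy h => rw [mul_smul_comm]; exact Submodule.smul_mem _ _ h)

/-- The action of `A_𝔭` on `V_𝔭` obtained from an action of `A` on `V` by extension of scalars:
`(a ⊗ h) · (b ⊗ x) = ab ⊗ (h · x)`. -/
def completedAction {A V : Type*} [Ring A] [Algebra K A] [AddCommGroup V] [Module K V]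
    (ρ : A →ₐ[K] Module.End K V) :
    v.adicCompletion K ⊗[K] A →ₐ[v.adicCompletion K]
      Module.End (v.adicCompletion K) (v.adicCompletion K ⊗[K] V) :=
  Algebra.TensorProduct.lift (Algebra.ofId _ _)
    ((Module.End.baseChangeHom K (v.adicCompletion K) V).comp ρ)
    (fun a _ => commute_ofId a _)

lemma completedAction_tmul {A V : Type*} [Ring A] [Algebra K A] [AddCommGroup V] [Module K V]
    (ρ : A →ₐ[K] Module.End K V) (a b : v.adicCompletion K) (h : A) (x : V) :
    completedAction v ρ (a ⊗ₜ h) (b ⊗ₜ x) = (a * b) ⊗ₜ (ρ h x) := by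
  rw [completedAction, Algebra.TensorProduct.lift_tmul, Algebra.ofId_apply, Module.End.mul_apply,
    Module.algebraMap_end_apply]
  change a • (b ⊗ₜ[K] ρ h x) = (a * b) ⊗ₜ[K] ρ h x
  rw [TensorProduct.smul_tmul', smul_eq_mul]

end Orders

section GreitherPareigis

variable (K L E : Type*) [Field K] [Field L] [Field E]
  [Algebra K L] [Algebra K E] [Algebra L E] [IsScalarTower K L E]

/-- The subgroup `G' = Gal(E/L)` of `G = Gal(E/K)`. -/
def fixingL : Subgroup (E ≃ₐ[K] E) := (IsScalarTower.toAlgHom K L E).fieldRange.fixingSubgroup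

/-- The left coset space `X = G / G'`. -/
abbrev CosetSpace : Type _ := (E ≃ₐ[K] E) ⧸ fixingL K L E

/-- The coset of the identity in `X`. -/
def baseCoset : CosetSpace K L E := QuotientGroup.mk 1

/-- The left translation map `λ : G → Perm X`, `λ(g)(x G') = (g x) G'`. -/
def translation : (E ≃ₐ[K] E) →* Equiv.Perm (CosetSpace K L E) :=
  MulAction.toPermHom (E ≃ₐ[K] E) (CosetSpace K L E)

/-- The `K`-embedding of `L` into `E` given by a coset `g G' ∈ X`, namely `x ↦ g x`. -/
def cosetEmb : CosetSpace K L E → (L →ₐ[K] E) :=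
  Quotient.lift (fun g : E ≃ₐ[K] E => (g : E →ₐ[K] E).comp (IsScalarTower.toAlgHom K L E)) <| by
    intro a b hab
    have h : a⁻¹ * b ∈ fixingL K L E := QuotientGroup.leftRel_apply.mp hab
    ext x
    have hx := (IntermediateField.mem_fixingSubgroup_iff _ _).mp h (algebraMap L E x) ⟨x, rfl⟩
    have : b (algebraMap L E x) = a (algebraMap L E x) := by
      have := congrArg a hx
      simpa [AlgEquiv.mul_apply, ← AlgEquiv.mul_apply a a⁻¹] using this
    simpa using this.symm

/-- A regular subgroup `N` of `Perm X` that is normalised by `λ(G)`.  These are the data which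
parametrise the Hopf-Galois structures on `L/K` (Greither and Pareigis). -/
structure RegularSubgroup where
  /-- The subgroup of `Perm X`. -/
  N : Subgroup (Equiv.Perm (CosetSpace K L E))
  card_eq : Nat.card N = Nat.card (CosetSpace K L E)
  transitive : ∀ x y : CosetSpace K L E, ∃ n ∈ N, n x = y
  normalised : ∀ g : E ≃ₐ[K] E, ∀ n ∈ N, translation K L E g * n * (translation K L E g)⁻¹ ∈ N

end GreitherPareigis

variable {K L E : Type*} [Field K] [Field L] [Field E]
  [Algebra K L] [Algebra K E] [Algebra L E] [IsScalarTower K L E]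

lemma cosetEmb_smul (τ : E ≃ₐ[K] E) (y : CosetSpace K L E) (x : L) :
    cosetEmb K L E (translation K L E τ y) x = τ (cosetEmb K L E y x) := by
  induction y using Quotient.inductionOn
  rfl

namespace RegularSubgroup

variable (S : RegularSubgroup K L E)

/-- Conjugation `n ↦ λ(g) n λ(g)⁻¹` on `N`. -/
def conj (g : E ≃ₐ[K] E) : S.N →* S.N where
  toFun n := ⟨translation K L E g * n * (translation K L E g)⁻¹, S.normalised g n n.2⟩
  map_one' := by ext; simp
  map_mul' a b := by ext; simp

/-- The action of `g ∈ G` on a group algebra `A[N]`: simultaneously on the coefficients through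
`σ` and on `N` by conjugation. -/
def twist {F A : Type*} [CommRing F] [CommRing A] [Algebra F A] (g : E ≃ₐ[K] E)
    (σ : A →ₐ[F] A) : MonoidAlgebra A S.N →ₐ[F] MonoidAlgebra A S.N :=
  (MonoidAlgebra.mapAlgHom S.N σ).comp (MonoidAlgebra.mapDomainAlgHom F A (S.conj g))

/-- The fixed points `A[N]^G`, where `g ∈ G` acts on the `F`-algebra `A` through `σ g`. -/
def fixedPoints {F A : Type*} [CommRing F] [CommRing A] [Algebra F A]
    (σ : (E ≃ₐ[K] E) → (A →ₐ[F] A)) : Subalgebra F (MonoidAlgebra A S.N) where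
  carrier := {z | ∀ g, S.twist g (σ g) z = z}
  mul_mem' ha hb g := by rw [map_mul, ha g, hb g]
  add_mem' ha hb g := by rw [map_add, ha g, hb g]
  algebraMap_mem' r g := AlgHom.commutes _ r

/-- The Hopf algebra `H = E[N]^G`. -/
def H : Subalgebra K (MonoidAlgebra E S.N) := S.fixedPoints fun g => (g : E →ₐ[K] E)

/-- `∑ c_n (n⁻¹ y) x` for `z = ∑ c_n n ∈ E[N]`, `y ∈ X` and `x ∈ L`. -/
def actAt (z : MonoidAlgebra E S.N) (y : CosetSpace K L E) (x : L) : E :=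
  z.coeff.sum fun n c => c * cosetEmb K L E ((n⁻¹ : S.N).1 y) x

lemma actAt_add_left (z w : MonoidAlgebra E S.N) (y : CosetSpace K L E) (x : L) :
    S.actAt (z + w) y x = S.actAt z y x + S.actAt w y x :=
  Finsupp.sum_add_index' (by simp) (by intros; ring)

lemma actAt_single (n : S.N) (c : E) (y : CosetSpace K L E) (x : L) :
    S.actAt (MonoidAlgebra.single n c) y x = c * cosetEmb K L E ((n⁻¹ : S.N).1 y) x :=
  Finsupp.sum_single_index (by simp)

lemma actAt_add_right (z : MonoidAlgebra E S.N) (y : CosetSpace K L E) (x x' : L) :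
    S.actAt z y (x + x') = S.actAt z y x + S.actAt z y x' := by
  simp [actAt, mul_add, Finsupp.sum_add]

lemma actAt_smul_right (z : MonoidAlgebra E S.N) (y : CosetSpace K L E) (k : K) (x : L) :
    S.actAt z y (k • x) = k • S.actAt z y x := by
  simp [actAt, Finsupp.smul_sum]

lemma actAt_twist (τ : E ≃ₐ[K] E) (z : MonoidAlgebra E S.N) (y : CosetSpace K L E) (x : L) :
    S.actAt (S.twist τ (τ : E →ₐ[K] E) z) (translation K L E τ y) x = τ (S.actAt z y x) := by
  induction z using MonoidAlgebra.induction_linear with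
  | zero => simp [actAt]
  | add f g hf hg => rw [map_add, actAt_add_left, actAt_add_left, map_add, hf, hg]
  | single n c =>
    have : S.twist τ (τ : E →ₐ[K] E) (MonoidAlgebra.single n c)
        = MonoidAlgebra.single (S.conj τ n) (τ c) := by
      simp [twist]
    rw [this, actAt_single, actAt_single, map_mul, ← cosetEmb_smul]
    simp [conj]

lemma actAt_of_mem {z : MonoidAlgebra E S.N} (hz : z ∈ S.H) (τ : E ≃ₐ[K] E)
    (y : CosetSpace K L E) (x : L) :
    S.actAt z (translation K L E τ y) x = τ (S.actAt z y x) := by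
  conv_lhs => rw [← hz τ]
  exact S.actAt_twist τ z y x

variable [NumberField K] [NumberField E] [IsNormalClosure K L E]

/-- For `z ∈ H` and `x ∈ L`, the element `∑ c_n (n⁻¹(1̄)) x` lies in `L`. -/
lemma exists_act {z : MonoidAlgebra E S.N} (hz : z ∈ S.H) (x : L) :
    ∃ l : L, algebraMap L E l = S.actAt z (baseCoset K L E) x := by
  have : Normal K E := IsNormalClosure.normal (F := K) (K := L) (L := E)
  have : IsGalois K E := {}
  have hmem : S.actAt z (baseCoset K L E) x ∈
      IntermediateField.fixedField (fixingL K L E) := by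
    rintro ⟨τ, hτ⟩
    have := S.actAt_of_mem hz τ (baseCoset K L E) x
    have hb : translation K L E τ (baseCoset K L E) = baseCoset K L E := by
      change (QuotientGroup.mk (τ * 1) : CosetSpace K L E) = QuotientGroup.mk 1
      rw [QuotientGroup.eq]
      simpa using hτ
    rw [hb] at this
    exact this.symm
  rw [fixingL, IsGalois.fixedField_fixingSubgroup] at hmem
  exact hmem

/-- The action of `h ∈ H` on `x ∈ L`: the element of `L` equal to `∑ c_n (n⁻¹(1̄)) x`. -/
def actFun (h : S.H) (x : L) : L := (S.exists_act h.2 x).choose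

lemma algebraMap_actFun (h : S.H) (x : L) :
    algebraMap L E (S.actFun h x) = S.actAt h.1 (baseCoset K L E) x :=
  (S.exists_act h.2 x).choose_spec

lemma cosetEmb_actFun (h : S.H) (y : CosetSpace K L E) (x : L) :
    cosetEmb K L E y (S.actFun h x) = S.actAt h.1 y x := by
  induction y using Quotient.inductionOn with
  | h g =>
    have h1 := S.actAt_of_mem h.2 g (baseCoset K L E) x
    have hb : translation K L E g (baseCoset K L E) = (⟦g⟧ : CosetSpace K L E) := by
      change (QuotientGroup.mk (g * 1) : CosetSpace K L E) = QuotientGroup.mk g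
      rw [mul_one]
    rw [hb] at h1
    rw [h1, ← algebraMap_actFun]
    rfl

lemma actAt_mul (z : MonoidAlgebra E S.N) (k : S.H) (y : CosetSpace K L E) (x : L) :
    S.actAt (z * k.1) y x = S.actAt z y (S.actFun k x) := by
  induction z using MonoidAlgebra.induction_linear with
  | zero => simp [actAt]
  | add f g hf hg => rw [add_mul, actAt_add_left, actAt_add_left, hf, hg]
  | single n c =>
    rw [actAt_single, cosetEmb_actFun]
    generalize k.1 = w
    induction w using MonoidAlgebra.induction_linear with
    | zero => simp [actAt]
    | add f g hf hg => rw [mul_add, actAt_add_left, actAt_add_left, hf, hg, mul_add]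
    | single m d =>
      rw [MonoidAlgebra.single_mul_single, actAt_single, actAt_single, mul_assoc]
      simp

/-- The action of `H` on `L`, as a homomorphism of `K`-algebras `H → End_K(L)`. -/
def act : S.H →ₐ[K] Module.End K L :=
  AlgHom.ofLinearMap
    { toFun := fun h =>
        { toFun := S.actFun h
          map_add' := fun x y => (algebraMap L E).injective <| by
            simp [algebraMap_actFun, actAt_add_right]
          map_smul' := fun k x => (algebraMap L E).injective <| by
            rw [RingHom.id_apply, Algebra.smul_def k (S.actFun h x), map_mul,
              ← IsScalarTower.algebraMap_apply, algebraMap_actFun, algebraMap_actFun,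
              actAt_smul_right, Algebra.smul_def] }
      map_add' := fun h k => by
        ext x
        exact (algebraMap L E).injective <| by
          simp [algebraMap_actFun, actAt_add_left]
      map_smul' := fun k h => by
        ext x
        apply (algebraMap L E).injective
        simp only [LinearMap.coe_mk, AddHom.coe_mk, RingHom.id_apply, LinearMap.smul_apply]
        rw [Algebra.smul_def k (S.actFun h x), map_mul,
              ← IsScalarTower.algebraMap_apply, algebraMap_actFun, algebraMap_actFun]
        simp only [actAt, SetLike.val_smul, MonoidAlgebra.coeff_smul]
        rw [Finsupp.sum_smul_index' (by simp), Finsupp.mul_sum]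
        simp [Algebra.smul_def, mul_assoc] }
    (by
      ext x
      apply (algebraMap L E).injective
      simp only [LinearMap.coe_mk, AddHom.coe_mk, Module.End.one_apply, algebraMap_actFun]
      rw [OneMemClass.coe_one, MonoidAlgebra.one_def, actAt_single]
      simp [baseCoset, cosetEmb, QuotientGroup.mk, Quotient.mk''])
    (by
      intro h k
      ext x
      apply (algebraMap L E).injective
      simp only [LinearMap.coe_mk, AddHom.coe_mk, Module.End.mul_apply, algebraMap_actFun]
      exact S.actAt_mul _ _ _ _)

/-- The ring of integers of `L`, as an `𝓞_K`-subalgebra of the `K`-algebra `L`. -/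
def integers (K L : Type*) [Field K] [Field L] [Algebra K L] : Subalgebra (𝓞 K) L :=
  (IsScalarTower.toAlgHom (𝓞 K) (𝓞 L) L).range

/-- The associated order `𝔄_H = {h ∈ H | h · x ∈ 𝓞_L for all x ∈ 𝓞_L}`. -/
def associatedOrder : Subalgebra (𝓞 K) S.H where
  carrier := {h | ∀ x ∈ integers K L, S.act h x ∈ integers K L}
  mul_mem' ha hb x hx := by
    rw [map_mul]
    exact ha _ (hb x hx)
  add_mem' ha hb x hx := by
    rw [map_add]
    exact add_mem (ha x hx) (hb x hx)
  algebraMap_mem' r x hx := by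
    rw [IsScalarTower.algebraMap_apply (𝓞 K) K S.H, AlgHom.commutes, Module.algebraMap_end_apply,
      algebraMap_smul]
    exact Subalgebra.smul_mem _ hx r

variable (v : HeightOneSpectrum (𝓞 K))

/-- The completed associated order `𝔄_{H,𝔭}` in `H_𝔭 = K_𝔭 ⊗_K H`. -/
abbrev completedAssociatedOrder :
    Subalgebra (v.adicCompletionIntegers K) (v.adicCompletion K ⊗[K] S.H) :=
  completedOrder v S.associatedOrder

/-- The completed ring of integers `𝓞_{L,𝔭}` in `L_𝔭 = K_𝔭 ⊗_K L`. -/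
abbrev completedIntegers (L : Type*) [Field L] [Algebra K L] :
    Subalgebra (v.adicCompletionIntegers K) (v.adicCompletion K ⊗[K] L) :=
  completedOrder v (integers K L)

lemma completedAction_mem {h : v.adicCompletion K ⊗[K] S.H}
    (hh : h ∈ S.completedAssociatedOrder v) {x : v.adicCompletion K ⊗[K] L}
    (hx : x ∈ completedIntegers v L) :
    completedAction v S.act h x ∈ completedIntegers v L := by
  change h ∈ completedLattice v _ at hh
  change x ∈ completedLattice v _ at hx
  change _ ∈ completedLattice v _
  induction hh, hx using Submodule.span_induction₂ with
  | mem_mem x y hx hy =>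
    obtain ⟨a, ha, rfl⟩ := hx
    obtain ⟨b, hb, rfl⟩ := hy
    rw [completedAction_tmul]
    exact Submodule.subset_span ⟨_, ha b hb, by rw [one_mul]⟩
  | zero_left y hy => simp
  | zero_right x hx => simp
  | add_left x y z hx hy hz h1 h2 =>
    rw [map_add, LinearMap.add_apply]; exact Submodule.add_mem _ h1 h2
  | add_right x y z hx hy hz h1 h2 => rw [map_add]; exact Submodule.add_mem _ h1 h2
  | smul_left r x y hx hy h =>
    rw [← algebraMap_smul (v.adicCompletion K) r x, map_smul, LinearMap.smul_apply,
      algebraMap_smul]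
    exact Submodule.smul_mem _ _ h
  | smul_right r x y hx hy h =>
    rw [← algebraMap_smul (v.adicCompletion K) r y, map_smul, algebraMap_smul]
    exact Submodule.smul_mem _ _ h

/-- `𝓞_{L,𝔭}` as a module over `𝔄_{H,𝔭}`, through the action of `H_𝔭` on `L_𝔭`. -/
instance completedIntegersModule :
    Module (S.completedAssociatedOrder v) (completedIntegers v L) where
  smul h x := ⟨completedAction v S.act h.1 x.1, S.completedAction_mem v h.2 x.2⟩
  one_smul x := Subtype.ext <| by
    change completedAction v S.act 1 x.1 = x.1
    rw [map_one]; rfl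
  mul_smul h k x := Subtype.ext <| by
    change completedAction v S.act (h.1 * k.1) x.1 = _
    rw [map_mul]; rfl
  smul_zero h := Subtype.ext <| map_zero (completedAction v S.act h.1)
  smul_add h x y := Subtype.ext <| map_add (completedAction v S.act h.1) _ _
  add_smul h k x := Subtype.ext <| by
    change completedAction v S.act (h.1 + k.1) x.1 = _
    rw [map_add]; rfl
  zero_smul x := Subtype.ext <| by
    change completedAction v S.act 0 x.1 = 0
    rw [map_zero]; rfl

/-- The canonical embedding `H_𝔭 = K_𝔭 ⊗_K E[N]^G → E_𝔭[N]`, where `E_𝔭 = K_𝔭 ⊗_K E`: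
`a ⊗ ∑ c_n n ↦ ∑ (a ⊗ c_n) n`. -/
def completedInclusion : v.adicCompletion K ⊗[K] S.H →ₐ[v.adicCompletion K]
    MonoidAlgebra (v.adicCompletion K ⊗[K] E) S.N :=
  Algebra.TensorProduct.lift (Algebra.ofId _ _)
    ((MonoidAlgebra.mapAlgHom S.N
      (Algebra.TensorProduct.includeRight : E →ₐ[K] v.adicCompletion K ⊗[K] E)).comp S.H.val)
    (fun a _ => commute_ofId a _)

/-- `E_𝔭[N]^G`, where `g ∈ G` acts on `E_𝔭 = K_𝔭 ⊗_K E` as `1 ⊗ g`. -/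
def completedFixedPoints : Subalgebra (v.adicCompletion K)
    (MonoidAlgebra (v.adicCompletion K ⊗[K] E) S.N) :=
  S.fixedPoints fun g =>
    Algebra.TensorProduct.map (AlgHom.id (v.adicCompletion K) (v.adicCompletion K))
      (g : E →ₐ[K] E)

/-- `𝓞_{E,𝔭}[N]^G`: the elements of `E_𝔭[N]^G` all of whose coefficients lie in `𝓞_{E,𝔭}`. -/
def completedIntegralFixedPoints : Set (MonoidAlgebra (v.adicCompletion K ⊗[K] E) S.N) :=
  {z | z ∈ S.completedFixedPoints v ∧ ∀ n : S.N, z.coeff n ∈ completedIntegers v E}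

end RegularSubgroup

end HopfGalois

end

/-! The heart of the matter is a trace computation. For `z = ∑ c_n n` in a group algebra of a finite
group `N`, left multiplication by `z` has trace `|N| c_1`. If `N` is abelian and `z` is integral,
then `n⁻¹ z` is integral too, so every `|N| c_n` is integral
(`MonoidAlgebra.isIntegral_card_mul_coeff`). By Galois descent `H` spans `E[N]` over `E` (`span_H`),
so commutativity of `H` makes `N` abelian; and `|N| = |X| = [L:K]` is prime to `𝔭`. Hence integral
elements of `H` have `𝔭`-integral coefficients. Conversely, an element of `H` with integral
coefficients preserves `𝓞_L`, and the associated order is finitely generated, hence consists of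
integral elements. So at `𝔭` three conditions coincide: lying in the associated order, being
integral, and having integral coefficients. This gives the description by fixed points, and the
maximality, since every order consists of integral elements.

Completed statements reduce to these global ones: any `z` in `H_𝔭` is an element of the completed
order plus some `1 ⊗ h`, and both `1 ⊗ h ∈ Λ_𝔭` and integrality of `1 ⊗ h` descend to `h` up to a
multiplier outside `𝔭` (`mem_localizedLattice_of_one_tmul_mem`,
`exists_isIntegral_smul_of_isIntegral_tmul`).

For freeness, finite generation of the integral elements forces `H_𝔭` to be reduced, hence a finite
product of fields in which the integral elements form a product of principal ideal domains. Since
`L_𝔭` is faithful over `H_𝔭` and of no larger dimension, it is free of rank one. The lattice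
`𝓞_{L,𝔭}` then becomes a full fractional ideal, which is principal
(`exists_generator_of_isIntegral_stable`). -/

/-! ### Lattices over the integral elements of a commutative algebra over a discrete valuation ring
-/

/-- A nonzero nilpotent `z` would make the whole line `F z` integral, so `F` would embed in the
Noetherian `O`-module `M` and be finite over `O`, forcing `O` to be a field. -/
theorem isReduced_of_fg_of_isIntegral_mem {O F A : Type*} [CommRing O] [IsDomain O]
    [IsDiscreteValuationRing O] [Field F] [Algebra O F] [IsFractionRing O F] [CommRing A]
    [Algebra F A] [Algebra O A] [IsScalarTower O F A] (M : Submodule O A) (hM : M.FG)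
    (h : ∀ a : A, IsIntegral O a → a ∈ M) : IsReduced A := by
  refine ⟨fun z hz => ?_⟩
  by_contra hz0
  let f : F →ₗ[O] A := (LinearMap.toSpanSingleton F A z).restrictScalars O
  have hf : Function.Injective f := fun a b hab => smul_left_injective F hz0 hab
  have hle : LinearMap.range f ≤ M := by
    rintro _ ⟨c, rfl⟩
    refine h _ ?_
    obtain ⟨k, hk⟩ := hz
    refine ⟨Polynomial.X ^ k, Polynomial.monic_X_pow k, ?_⟩
    simp [f, smul_pow, hk]
  have : Module.Finite O M := Module.Finite.iff_fg.mpr hM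
  have : Module.Finite O F :=
    Module.Finite.of_injective (f.codRestrict M fun c => hle ⟨c, rfl⟩)
      fun a b hab => hf (congrArg Subtype.val hab)
  exact IsDiscreteValuationRing.not_isField O
    (isField_of_isIntegral_of_isField (IsFractionRing.injective O F) (Field.toIsField F))

/-- The integral closure of `O` in `k` is a Dedekind domain with finitely many primes, hence
principal; `J` is one of its fractional ideals and `u` a generator. -/
theorem exists_mem_iff_isIntegral_div {O F k : Type*} [CommRing O] [IsDomain O]
    [IsDiscreteValuationRing O] [Field F] [CharZero F] [Algebra O F] [IsFractionRing O F] [Field k]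
    [Algebra F k] [Algebra O k] [IsScalarTower O F k] [FiniteDimensional F k]
    (J : Submodule O k) (hJ : J.FG) (hJ0 : J ≠ ⊥)
    (h : ∀ a : k, IsIntegral O a → ∀ b ∈ J, a * b ∈ J) :
    ∃ u : k, u ≠ 0 ∧ ∀ a, a ∈ J ↔ IsIntegral O (a / u) := by
  let D := integralClosure O k
  have : IsIntegralClosure D O k := inferInstance
  have : IsDedekindDomain D := IsIntegralClosure.isDedekindDomain O F k D
  have : IsFractionRing D k := IsIntegralClosure.isFractionRing_of_finite_extension O F k D
  have : Module.Finite O D := IsIntegralClosure.finite O F k D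
  -- A prime of a discrete valuation ring is determined by whether it is zero.
  have : Finite (PrimeSpectrum O) := by
    refine Finite.of_injective (fun P : PrimeSpectrum O => P.asIdeal = ⊥) fun P Q hPQ => ?_
    have hPQ' : P.asIdeal = ⊥ ↔ Q.asIdeal = ⊥ := iff_of_eq hPQ
    ext1
    by_cases hP : P.asIdeal = ⊥
    · rw [hP, hPQ'.mp hP]
    · rw [IsLocalRing.eq_maximalIdeal (P.isPrime.isMaximal hP),
        IsLocalRing.eq_maximalIdeal (Q.isPrime.isMaximal fun h => hP (hPQ'.mpr h))]
  have : Finite (PrimeSpectrum D) := Algebra.QuasiFinite.finite_primeSpectrum O D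
  have : IsPrincipalIdealRing D := IsPrincipalIdealRing.of_finite_primes (by
    refine (Set.finite_range (PrimeSpectrum.asIdeal : PrimeSpectrum D → Ideal D)).subset ?_
    intro I hI
    exact ⟨⟨I, hI⟩, rfl⟩)
  let J' : Submodule D k :=
    { J.toAddSubmonoid with smul_mem' := fun c x hx => h c.1 c.2 x hx }
  have hmem : ∀ x, x ∈ J' ↔ x ∈ J := fun x => Iff.rfl
  have hfg : J'.FG := by
    obtain ⟨s, hs⟩ := hJ
    refine ⟨s, le_antisymm (Submodule.span_le.mpr fun x hx => ?_) fun x hx => ?_⟩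
    · have : x ∈ J := by rw [← hs]; exact Submodule.subset_span hx
      exact this
    · have hx' : x ∈ Submodule.span O (s : Set k) := by rw [hs]; exact hx
      exact Submodule.span_le_restrictScalars O D (s : Set k) hx'
  let I : FractionalIdeal (nonZeroDivisors D) k := ⟨J', FractionalIdeal.isFractional_of_fg hfg⟩
  have hI := FractionalIdeal.isPrincipal I
  obtain ⟨u, hu⟩ := hI.principal
  have hu' : J' = Submodule.span D {u} := hu
  have hu0 : u ≠ 0 := by
    rintro rfl
    apply hJ0
    rw [eq_bot_iff]
    intro x hx
    have : x ∈ J' := hx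
    rw [hu'] at this
    simpa using this
  refine ⟨u, hu0, fun a => ?_⟩
  rw [← hmem, hu', Submodule.mem_span_singleton]
  constructor
  · rintro ⟨c, rfl⟩
    have : c • u / u = c.1 := by
      rw [Subalgebra.smul_def, smul_eq_mul, mul_div_assoc, div_self hu0, mul_one]
    rw [this]
    exact c.2
  · intro ha
    exact ⟨⟨a / u, ha⟩, by rw [Subalgebra.smul_def, smul_eq_mul, div_mul_cancel₀ _ hu0]⟩

theorem isIntegral_pi_of_forall {R ι : Type*} [CommRing R] [Finite ι] {B : ι → Type*}
    [∀ i, CommRing (B i)] [∀ i, Algebra R (B i)] (x : ∀ i, B i) (h : ∀ i, IsIntegral R (x i)) :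
    IsIntegral R x := by
  have := Fintype.ofFinite ι
  choose p hp hx using h
  refine ⟨∏ i, p i, Polynomial.monic_prod_of_monic _ _ fun i _ => hp i, ?_⟩
  ext i
  -- The product of the monic equations of all components annihilates each component.
  change Pi.evalAlgHom R B i (Polynomial.aeval x (∏ i, p i)) = 0
  rw [← Polynomial.aeval_algHom_apply, map_prod]
  exact Finset.prod_eq_zero (Finset.mem_univ i) (hx i)

/-- A reduced Artinian `A` is the product of its residue fields, and integrality is tested factor by
factor. The integral idempotents split `J` accordingly, so the field case supplies a generator in
each factor; full rank of `J` keeps every factor nonzero. -/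
theorem exists_isUnit_mem_iff_isIntegral {O F A : Type*} [CommRing O] [IsDomain O]
    [IsDiscreteValuationRing O] [Field F] [CharZero F] [Algebra O F] [IsFractionRing O F]
    [CommRing A] [Algebra F A] [Algebra O A] [IsScalarTower O F A] [FiniteDimensional F A]
    [IsReduced A] (J : Submodule O A) (hJ : J.FG) (hspan : Submodule.span F (J : Set A) = ⊤)
    (h : ∀ a : A, IsIntegral O a → ∀ b ∈ J, a * b ∈ J) :
    ∃ u : A, IsUnit u ∧ ∀ a, a * u ∈ J ↔ IsIntegral O a := by
  classical
  have : IsArtinianRing A := IsArtinianRing.of_finite F A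
  have := Fintype.ofFinite (MaximalSpectrum A)
  let (m : MaximalSpectrum A) : Field (A ⧸ m.asIdeal) := Ideal.Quotient.field m.asIdeal
  let e : A ≃ₐ[O] ∀ m : MaximalSpectrum A, A ⧸ m.asIdeal :=
    (IsArtinianRing.equivPi A).restrictScalars O
  let q (m : MaximalSpectrum A) : A →ₐ[O] A ⧸ m.asIdeal :=
    (Pi.evalAlgHom O _ m).comp e.toAlgHom
  have hq (m : MaximalSpectrum A) (a : A) : q m a = e a m := rfl
  have hqF (m : MaximalSpectrum A) (a : A) :
      q m a = IsScalarTower.toAlgHom F A (A ⧸ m.asIdeal) a := rfl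
  have hint (a : A) : IsIntegral O a ↔ ∀ m, IsIntegral O (q m a) := by
    refine ⟨fun ha m => ha.map (q m), fun ha => ?_⟩
    have h1 : IsIntegral O (e a) := isIntegral_pi_of_forall _ ha
    simpa using h1.map e.symm
  let s (m : MaximalSpectrum A) (x : A ⧸ m.asIdeal) : A := e.symm (Pi.single m x)
  have hs (m : MaximalSpectrum A) (x : A ⧸ m.asIdeal) : q m (s m x) = x := by
    simp [hq, s]
  have hs' (m m' : MaximalSpectrum A) (hm : m' ≠ m) (x : A ⧸ m.asIdeal) :
      q m' (s m x) = 0 := by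
    simp [hq, s, hm]
  have hsint (m : MaximalSpectrum A) (x : A ⧸ m.asIdeal) (hx : IsIntegral O x) :
      IsIntegral O (s m x) := by
    rw [hint]
    intro m'
    by_cases hm : m' = m
    · subst hm; rwa [hs]
    · rw [hs' _ _ hm]; exact isIntegral_zero
  have key (m : MaximalSpectrum A) : ∃ u : A ⧸ m.asIdeal, u ≠ 0 ∧
      ∀ a, a ∈ J.map (q m).toLinearMap ↔ IsIntegral O (a / u) := by
    refine exists_mem_iff_isIntegral_div (F := F) _ (hJ.map _) ?_ ?_
    · intro h0
      have hle : Submodule.span F (J : Set A) ≤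
          LinearMap.ker (IsScalarTower.toAlgHom F A (A ⧸ m.asIdeal)).toLinearMap := by
        refine Submodule.span_le.mpr fun x hx => ?_
        have : q m x ∈ J.map (q m).toLinearMap := ⟨x, hx, rfl⟩
        rw [h0, Submodule.mem_bot, hqF] at this
        exact this
      have h1 : (1 : A) ∈ Submodule.span F (J : Set A) := hspan ▸ Submodule.mem_top
      have h2 := hle h1
      rw [LinearMap.mem_ker, AlgHom.toLinearMap_apply, map_one] at h2
      exact one_ne_zero h2
    · rintro a ha _ ⟨b, hb, rfl⟩
      refine ⟨s m a * b, h _ (hsint m a ha) b hb, ?_⟩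
      rw [AlgHom.toLinearMap_apply, map_mul, hs, AlgHom.toLinearMap_apply]
  choose u hu0 hu using key
  have hmem (a : A) : a ∈ J ↔ ∀ m, q m a ∈ J.map (q m).toLinearMap := by
    refine ⟨fun ha m => ⟨a, ha, rfl⟩, fun ha => ?_⟩
    choose j hj hj' using ha
    -- The `s m 1` are the primitive idempotents. They are integral, so `J` is stable under them and
    -- `a` can be glued from elements of `J` that agree with it in one factor each.
    have : a = ∑ m, s m 1 * j m := by
      apply e.injective
      ext m
      rw [← hq, ← hq, map_sum, Finset.sum_eq_single m, map_mul, hs, one_mul]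
      · exact (hj' m).symm
      · intro m' _ hm
        rw [map_mul, hs' _ _ hm.symm, zero_mul]
      · simp
    rw [this]
    exact Submodule.sum_mem _ fun m _ => h _ (hsint m 1 isIntegral_one) _ (hj m)
  refine ⟨e.symm u, ?_, fun a => ?_⟩
  · refine IsUnit.map e.symm (Pi.isUnit_iff.mpr fun m => (hu0 m).isUnit)
  · rw [hmem, hint]
    refine forall_congr' fun m => ?_
    have : q m (e.symm u) = u m := by simp [hq]
    rw [hu, map_mul, this, mul_div_assoc, div_self (hu0 m), mul_one]

/-- Faithfulness gives, for each primitive idempotent, a vector it does not kill. The sum of their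
projections has trivial annihilator, and the dimension bound turns injectivity into bijectivity. -/
theorem exists_bijective_apply_of_injective {F A W : Type*} [Field F] [CommRing A] [Algebra F A]
    [FiniteDimensional F A] [IsReduced A] [AddCommGroup W] [Module F W] [FiniteDimensional F W]
    (ρ : A →ₐ[F] Module.End F W) (hρ : Function.Injective ρ)
    (hdim : Module.finrank F W ≤ Module.finrank F A) :
    ∃ w : W, Function.Bijective fun a => ρ a w := by
  classical
  have : IsArtinianRing A := IsArtinianRing.of_finite F A
  have := Fintype.ofFinite (MaximalSpectrum A)
  let (m : MaximalSpectrum A) : Field (A ⧸ m.asIdeal) := Ideal.Quotient.field m.asIdeal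
  let e := IsArtinianRing.equivPi A
  let s (m : MaximalSpectrum A) : A := e.symm (Pi.single m 1)
  have hs0 (m : MaximalSpectrum A) : s m ≠ 0 := by
    simp [s]
  have key (m : MaximalSpectrum A) : ∃ w, ρ (s m) w ≠ 0 := by
    by_contra! hw
    exact hs0 m (hρ (by rw [map_zero]; exact LinearMap.ext hw))
  choose w hw using key
  have hss (m m' : MaximalSpectrum A) : s m * s m' = if m = m' then s m else 0 := by
    apply e.injective
    ext m''
    by_cases h : m = m'
    · subst h
      by_cases h' : m'' = m
      · subst h'; simp [s]
      · simp [s, h']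
    · by_cases h' : m'' = m
      · subst h'; simp [s, h]
      · simp [s, h, h']
  let φ : A →ₗ[F] W := (LinearMap.applyₗ (∑ m, ρ (s m) (w m))).comp ρ.toLinearMap
  have hφ (a : A) : φ a = ρ a (∑ m, ρ (s m) (w m)) := rfl
  have hinj : Function.Injective φ := by
    rw [← LinearMap.ker_eq_bot, LinearMap.ker_eq_bot']
    intro a ha
    by_contra ha0
    have : ∃ m, e a m ≠ 0 := by
      by_contra! h0
      exact ha0 (e.injective (by rw [map_zero]; exact funext h0))
    obtain ⟨m, hm⟩ := this
    -- A nonzero `a` has a multiple equal to a primitive idempotent, so if `a` killed the chosen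
    -- vector, `s m` would kill `w m`.
    have h1 : e.symm (Pi.single m (e a m)⁻¹) * s m * a = s m := by
      apply e.injective
      ext m''
      by_cases h' : m'' = m
      · subst h'; simp [s, hm]
      · simp [s, h']
    apply hw m
    have h2 : ρ (s m) (∑ m, ρ (s m) (w m)) = ρ (s m) (w m) := by
      rw [map_sum, Finset.sum_eq_single m]
      · rw [← Module.End.mul_apply, ← map_mul, hss, if_pos rfl]
      · intro m' _ hm'
        rw [← Module.End.mul_apply, ← map_mul, hss, if_neg hm'.symm, map_zero,
          LinearMap.zero_apply]
      · simp
    rw [← h2, ← h1, map_mul, Module.End.mul_apply, ← hφ a, ha, map_zero]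
  refine ⟨_, hinj, ?_⟩
  exact (LinearMap.injective_iff_surjective_of_finrank_eq_finrank
    (le_antisymm (LinearMap.finrank_le_finrank_of_injective hinj) hdim)).mp hinj

theorem exists_generator_of_isIntegral_stable {O F A W : Type*} [CommRing O] [IsDomain O]
    [IsDiscreteValuationRing O] [Field F] [CharZero F] [Algebra O F] [IsFractionRing O F]
    [CommRing A] [Algebra F A] [Algebra O A] [IsScalarTower O F A] [FiniteDimensional F A]
    [IsReduced A] [AddCommGroup W] [Module F W] [FiniteDimensional F W] [Module O W]
    [IsScalarTower O F W] (ρ : A →ₐ[F] Module.End F W) (hρ : Function.Injective ρ)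
    (hdim : Module.finrank F W ≤ Module.finrank F A) (V : Submodule O W) (hV : V.FG)
    (hspan : Submodule.span F (V : Set W) = ⊤)
    (h : ∀ a : A, IsIntegral O a → ∀ x ∈ V, ρ a x ∈ V) :
    ∃ w : W, Function.Bijective (fun a => ρ a w) ∧ ∀ a, ρ a w ∈ V ↔ IsIntegral O a := by
  obtain ⟨w, hw⟩ := exists_bijective_apply_of_injective ρ hρ hdim
  let φ : A ≃ₗ[F] W :=
    LinearEquiv.ofBijective ((LinearMap.applyₗ w).comp ρ.toLinearMap) hw
  have hφ (a : A) : φ a = ρ a w := rfl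
  let ψ : A ≃ₗ[O] W := φ.restrictScalars O
  obtain ⟨u, hu, hJ⟩ := exists_isUnit_mem_iff_isIntegral (F := F) (V.comap ψ.toLinearMap)
    (by
      have := hV.map ψ.symm.toLinearMap
      rwa [Submodule.map_equiv_eq_comap_symm ψ.symm V] at this)
    (by
      have h1 : (φ.symm : W →ₗ[F] A) '' (V : Set W) =
          ((V.comap ψ.toLinearMap : Submodule O A) : Set A) := by
        ext a
        constructor
        · rintro ⟨x, hx, rfl⟩
          change φ (φ.symm x) ∈ V
          rwa [LinearEquiv.apply_symm_apply]
        · intro ha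
          exact ⟨φ a, ha, φ.symm_apply_apply a⟩
      rw [← h1, ← Submodule.map_span, hspan, Submodule.map_top]
      exact φ.symm.range)
    (by
      intro a ha b hb
      change φ (a * b) ∈ V
      rw [hφ, map_mul, Module.End.mul_apply]
      exact h a ha _ hb)
  -- Pulled back along `a ↦ ρ a w`, the lattice `V` is generated by the unit `u` over the integral
  -- elements; moving the cyclic vector from `w` to `ρ u w` normalises that generator to `1`.
  refine ⟨φ u, ⟨fun a b hab => ?_, fun x => ?_⟩, fun a => ?_⟩
  · simp only [hφ, ← Module.End.mul_apply, ← map_mul] at hab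
    exact hu.mul_left_injective (φ.injective hab)
  · obtain ⟨u', hu'⟩ := hu.exists_left_inv
    refine ⟨φ.symm x * u', ?_⟩
    simp only [hφ, ← Module.End.mul_apply, ← map_mul]
    rw [mul_assoc, hu', mul_one, ← hφ, LinearEquiv.apply_symm_apply]
  · rw [← hJ, hφ, ← Module.End.mul_apply, ← map_mul]
    rfl

/-! ### Passing between the completion and the localisation at a prime -/

noncomputable section
namespace HopfGalois

section Completion

variable {K : Type*} [Field K] [NumberField K] (v : HeightOneSpectrum (𝓞 K))

theorem exists_sub_algebraMap_eq_mul (a : v.adicCompletion K) {d : 𝓞 K} (hd : d ≠ 0) :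
    ∃ (k : K) (r : v.adicCompletionIntegers K),
      a - algebraMap K (v.adicCompletion K) k = algebraMap (𝓞 K) (v.adicCompletion K) d * r := by
  set δ := algebraMap (𝓞 K) (v.adicCompletion K) d with hδ
  have hδ0 : δ ≠ 0 := by
    rw [hδ, IsScalarTower.algebraMap_apply (𝓞 K) K]
    simpa using hd
  -- The congruence class of `a` modulo `d` is open and contains `a`, so it meets the dense subfield
  -- `K`.
  have hopen : IsOpen ((fun x => δ⁻¹ * (a - x)) ⁻¹'
      (v.adicCompletionIntegers K : Set (v.adicCompletion K))) :=
    (Valued.isOpen_valuationSubring _).preimage (by fun_prop)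
  obtain ⟨k, hk⟩ := (HeightOneSpectrum.denseRange_algebraMap K v).exists_mem_open hopen
    ⟨a, by simp [zero_mem]⟩
  refine ⟨k, ⟨_, hk⟩, ?_⟩
  change _ = δ * (δ⁻¹ * _)
  rw [mul_inv_cancel_left₀ hδ0]

theorem exists_notMem_mul_eq_algebraMap {k : K}
    (hk : algebraMap K (v.adicCompletion K) k ∈ v.adicCompletionIntegers K) :
    ∃ s ∉ v.asIdeal, ∃ n : 𝓞 K, algebraMap (𝓞 K) K s * k = algebraMap (𝓞 K) K n := by
  have h : v.valuation K k ≤ 1 := by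
    rw [← HeightOneSpectrum.valuedAdicCompletion_eq_valuation']
    exact hk
  obtain ⟨n, d, hnd⟩ := v.exists_primeCompl_mul_eq_of_integer k h
  exact ⟨d, d.2, n, by rw [mul_comm, hnd]⟩

theorem exists_mul_algebraMap_eq_one {s : 𝓞 K} (hs : s ∉ v.asIdeal) :
    ∃ r : v.adicCompletionIntegers K,
      (r : v.adicCompletion K) * algebraMap (𝓞 K) (v.adicCompletion K) s = 1 := by
  have h : IsUnit (algebraMap (𝓞 K) (v.adicCompletionIntegers K) s) := by
    rw [HeightOneSpectrum.adicCompletionIntegers.isUnit_iff_valued_eq_one,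
      HeightOneSpectrum.algebraMap_adicCompletionIntegers_apply,
      HeightOneSpectrum.valuedAdicCompletion_eq_valuation']
    exact (v.valuation_eq_one_iff_notMem (K := K)).mpr hs
  obtain ⟨r, hr⟩ := h.exists_left_inv
  exact ⟨r, congrArg Subtype.val hr⟩

variable {V : Type*} [AddCommGroup V] [Module K V] [Module (𝓞 K) V] [IsScalarTower (𝓞 K) K V]

/-- The elements of `V` which lie in the localisation of `M` at `v`. -/
def localizedLattice (M : Submodule (𝓞 K) V) : Submodule (𝓞 K) V where
  carrier := {x | ∃ s ∉ v.asIdeal, s • x ∈ M}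
  zero_mem' := ⟨1, v.isPrime.one_notMem, by simp⟩
  add_mem' := by
    rintro x y ⟨s, hs, hx⟩ ⟨t, ht, hy⟩
    refine ⟨s * t, v.isPrime.mul_notMem hs ht, ?_⟩
    rw [smul_add]
    refine add_mem ?_ ?_
    · rw [mul_comm, mul_smul]
      exact M.smul_mem _ hx
    · rw [mul_smul]
      exact M.smul_mem _ hy
  smul_mem' := by
    rintro c x ⟨s, hs, hx⟩
    exact ⟨s, hs, by rw [smul_comm]; exact M.smul_mem _ hx⟩

theorem smul_mem_localizedLattice {M : Submodule (𝓞 K) V} {k : K}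
    (hk : algebraMap K (v.adicCompletion K) k ∈ v.adicCompletionIntegers K) {x : V}
    (hx : x ∈ M) : k • x ∈ localizedLattice v M := by
  obtain ⟨s, hs, n, hn⟩ := exists_notMem_mul_eq_algebraMap v hk
  refine ⟨s, hs, ?_⟩
  rw [← algebraMap_smul K s, smul_smul, hn, algebraMap_smul]
  exact M.smul_mem _ hx

omit [IsScalarTower (𝓞 K) K V] in
theorem integers_tmul_mem_completedLattice {M : Submodule (𝓞 K) V}
    (r : v.adicCompletionIntegers K) {x : V} (hx : x ∈ M) :
    (r : v.adicCompletion K) ⊗ₜ[K] x ∈ completedLattice v M := by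
  have : (r : v.adicCompletion K) ⊗ₜ[K] x = r • (1 ⊗ₜ[K] x) := by
    rw [TensorProduct.smul_tmul']
    congr 1
    rw [Algebra.smul_def, mul_one]
    rfl
  rw [this]
  exact Submodule.smul_mem _ _ (Submodule.subset_span ⟨x, hx, rfl⟩)

theorem algebraMap_mul_tmul (d : 𝓞 K) (a : v.adicCompletion K) (x : V) :
    (algebraMap (𝓞 K) (v.adicCompletion K) d * a) ⊗ₜ[K] x = a ⊗ₜ[K] (d • x) := by
  rw [← algebraMap_smul K d x, ← TensorProduct.smul_tmul, Algebra.smul_def,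
    ← IsScalarTower.algebraMap_apply]

theorem one_tmul_mem_completedLattice {M : Submodule (𝓞 K) V} {x : V}
    (hx : x ∈ localizedLattice v M) : 1 ⊗ₜ[K] x ∈ completedLattice v M := by
  obtain ⟨s, hs, hx⟩ := hx
  obtain ⟨r, hr⟩ := exists_mul_algebraMap_eq_one v hs
  rw [← hr, mul_comm, algebraMap_mul_tmul]
  exact integers_tmul_mem_completedLattice v r hx

theorem exists_sub_one_tmul_mem_completedLattice {M : Submodule (𝓞 K) V}
    (hM : ∀ x : V, ∃ d : 𝓞 K, d ≠ 0 ∧ d • x ∈ M) (z : v.adicCompletion K ⊗[K] V) :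
    ∃ x : V, z - 1 ⊗ₜ[K] x ∈ completedLattice v M := by
  induction z with
  | zero => exact ⟨0, by simp⟩
  | add z w hz hw =>
    obtain ⟨x, hx⟩ := hz
    obtain ⟨y, hy⟩ := hw
    refine ⟨x + y, ?_⟩
    rw [TensorProduct.tmul_add, add_sub_add_comm]
    exact add_mem hx hy
  | tmul a x =>
    obtain ⟨d, hd, hdx⟩ := hM x
    obtain ⟨k, r, hr⟩ := exists_sub_algebraMap_eq_mul v a hd
    refine ⟨k • x, ?_⟩
    have : (1 : v.adicCompletion K) ⊗ₜ[K] (k • x)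
        = algebraMap K (v.adicCompletion K) k ⊗ₜ[K] x := by
      rw [← TensorProduct.smul_tmul, Algebra.smul_def, mul_one]
    rw [this, ← TensorProduct.sub_tmul, hr, algebraMap_mul_tmul]
    exact integers_tmul_mem_completedLattice v r hdx

/-- In an expression of `1 ⊗ x` through elements `m j` of `M`, replace the local coefficients by
elements of `K` close enough that the error has `𝔭`-integral coordinates in a basis drawn from the
`m j`. Neither finite generation of `M` nor finite dimension of `V` is needed. -/
theorem mem_localizedLattice_of_one_tmul_mem {M : Submodule (𝓞 K) V} {x : V}
    (hx : 1 ⊗ₜ[K] x ∈ completedLattice v M) : x ∈ localizedLattice v M := by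
  classical
  obtain ⟨n, r, g, hsum⟩ := Submodule.mem_span_set'.mp hx
  have hg : ∀ j, ∃ m ∈ M, (g j : v.adicCompletion K ⊗[K] V) = 1 ⊗ₜ[K] m := fun j => (g j).2
  choose m hmM hgm using hg
  -- The basis of the span is chosen among the `m j`, hence inside `M`; the vectors added when it is
  -- extended to `V` will have coordinate zero.
  obtain ⟨b, hbm, hbspan, hli⟩ := exists_linearIndependent K (Set.range m)
  replace hli : LinearIndepOn K id b := hli
  let B := Module.Basis.extend hli
  have hbsub : b ⊆ hli.extend (Set.subset_univ b) := hli.subset_extend _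
  have hBout : ∀ i : hli.extend (Set.subset_univ b), (i : V) ∉ b → ∀ j, B.coord i (m j) = 0 := by
    intro i hi j
    have hm : m j ∈ Submodule.span K b := hbspan ▸ Submodule.subset_span ⟨j, rfl⟩
    have hle : Submodule.span K b ≤ LinearMap.ker (B.coord i) := by
      refine Submodule.span_le.mpr fun y hy => ?_
      have : y = B ⟨y, hbsub hy⟩ := by simp [B]
      rw [SetLike.mem_coe, LinearMap.mem_ker, this, Module.Basis.coord_apply,
        Module.Basis.repr_self, Finsupp.single_eq_of_ne]
      rintro rfl
      exact hi hy
    exact hle hm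
  have hbfin : b.Finite := (Set.finite_range m).subset hbm
  -- A common denominator `d` of all coordinates of the `m j`; approximating modulo `d` then makes
  -- the coordinates of the error integral.
  obtain ⟨d, hd⟩ := IsLocalization.exist_integer_multiples_of_finset (nonZeroDivisors (𝓞 K))
    ((Finset.univ : Finset (Fin n)).biUnion fun j => (B.repr (m j)).support.image
      fun i => B.coord i (m j))
  have hd' : ∀ i j, ∃ c : 𝓞 K, algebraMap (𝓞 K) K c = algebraMap (𝓞 K) K d * B.coord i (m j) := by
    intro i j
    by_cases h0 : B.coord i (m j) = 0
    · exact ⟨0, by simp [h0]⟩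
    · obtain ⟨c, hc⟩ := hd (B.coord i (m j)) (by
        simp only [Finset.mem_biUnion, Finset.mem_univ, true_and, Finset.mem_image]
        exact ⟨j, i, Finsupp.mem_support_iff.mpr h0, rfl⟩)
      exact ⟨c, by rw [hc, Algebra.smul_def]⟩
  have hd0 : (d : 𝓞 K) ≠ 0 := nonZeroDivisors.coe_ne_zero d
  choose k ρ hk using fun j => exists_sub_algebraMap_eq_mul v (r j : v.adicCompletion K) hd0
  have hkint : ∀ j, algebraMap K (v.adicCompletion K) (k j) ∈ v.adicCompletionIntegers K := by
    intro j
    have : algebraMap K (v.adicCompletion K) (k j) = (r j : v.adicCompletion K) -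
        algebraMap (𝓞 K) (v.adicCompletion K) d * ρ j := by
      rw [← hk j]; ring
    rw [this]
    exact sub_mem (r j).2 (mul_mem (HeightOneSpectrum.coe_algebraMap_mem (𝓞 K) K v d) (ρ j).2)
  set x' := x - ∑ j, k j • m j with hx'
  have hcoord (i) : algebraMap K (v.adicCompletion K) (B.coord i x') =
      ∑ j, algebraMap (𝓞 K) (v.adicCompletion K) d * ρ j *
        algebraMap K (v.adicCompletion K) (B.coord i (m j)) := by
    let φ : v.adicCompletion K ⊗[K] V →ₗ[v.adicCompletion K] v.adicCompletion K :=
      (TensorProduct.AlgebraTensorModule.rid K (v.adicCompletion K)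
        (v.adicCompletion K)).toLinearMap ∘ₗ (B.coord i).baseChange (v.adicCompletion K)
    have hφ (a : v.adicCompletion K) (y : V) :
        φ (a ⊗ₜ y) = a * algebraMap K (v.adicCompletion K) (B.coord i y) := by
      simp [φ, Algebra.smul_def, mul_comm]
    have h1 := congrArg φ hsum
    rw [hφ, one_mul, map_sum] at h1
    rw [hx', map_sub, map_sub, ← h1, map_sum, map_sum, ← Finset.sum_sub_distrib]
    refine Finset.sum_congr rfl fun j _ => ?_
    rw [hgm, ← hk j, ← algebraMap_smul (v.adicCompletion K) (r j), map_smul, hφ, map_smul,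
      smul_eq_mul, smul_eq_mul, map_mul, sub_mul, one_mul]
    rfl
  have hx'mem : x' ∈ localizedLattice v M := by
    rw [← B.linearCombination_repr x', Finsupp.linearCombination_apply]
    refine Submodule.sum_mem _ fun i hi => ?_
    have hib : (i : V) ∈ b := by
      by_contra hib
      refine Finsupp.mem_support_iff.mp hi ?_
      have := hcoord i
      simp only [hBout i hib, map_zero, mul_zero, Finset.sum_const_zero] at this
      exact (map_eq_zero _).mp this
    obtain ⟨j, hj⟩ := hbm hib
    have hBi : B i = m j := by simp [B, hj]
    simp only [hBi]
    refine smul_mem_localizedLattice v ?_ (hmM j)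
    have := hcoord i
    rw [Module.Basis.coord_apply] at this
    rw [this]
    refine sum_mem fun j _ => ?_
    obtain ⟨c, hc⟩ := hd' i j
    have : algebraMap (𝓞 K) (v.adicCompletion K) d * ρ j *
        algebraMap K (v.adicCompletion K) (B.coord i (m j)) =
        ρ j * algebraMap (𝓞 K) (v.adicCompletion K) c := by
      rw [IsScalarTower.algebraMap_apply (𝓞 K) K _ c, hc, map_mul,
        ← IsScalarTower.algebraMap_apply]
      ring
    rw [this]
    exact mul_mem (ρ j).2 (HeightOneSpectrum.coe_algebraMap_mem (𝓞 K) K v c)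
  have hxx : x = x' + ∑ j, k j • m j := by rw [hx']; abel
  rw [hxx]
  exact add_mem hx'mem (Submodule.sum_mem _ fun j _ =>
    smul_mem_localizedLattice v (hkint j) (hmM j))

theorem completedLattice_fg {M : Submodule (𝓞 K) V} (hM : M.FG) : (completedLattice v M).FG := by
  classical
  obtain ⟨s, hs⟩ := hM
  refine ⟨s.image fun x => 1 ⊗ₜ[K] x, le_antisymm (Submodule.span_mono ?_)
    (Submodule.span_le.mpr ?_)⟩
  · intro z hz
    obtain ⟨x, hx, rfl⟩ := Finset.mem_image.mp hz
    exact ⟨x, hs ▸ Submodule.subset_span hx, rfl⟩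
  · rintro _ ⟨m, hm, rfl⟩
    rw [← hs] at hm
    induction hm using Submodule.span_induction with
    | mem x hx => exact Submodule.subset_span (Finset.mem_image_of_mem _ hx)
    | zero => simp
    | add x y _ _ hx hy => rw [TensorProduct.tmul_add]; exact add_mem hx hy
    | smul c x _ hx =>
      rw [← algebraMap_mul_tmul, mul_one]
      have : algebraMap (𝓞 K) (v.adicCompletion K) c ⊗ₜ[K] x =
          algebraMap (𝓞 K) (v.adicCompletionIntegers K) c • ((1 : v.adicCompletion K) ⊗ₜ[K] x) := by
        rw [TensorProduct.smul_tmul']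
        congr 1
        rw [Algebra.smul_def, mul_one]
        rfl
      rw [this]
      exact Submodule.smul_mem _ _ hx

theorem span_completedLattice_eq_top {M : Submodule (𝓞 K) V}
    (hM : ∀ x : V, ∃ d : 𝓞 K, d ≠ 0 ∧ d • x ∈ M) :
    Submodule.span (v.adicCompletion K)
      (completedLattice v M : Set (v.adicCompletion K ⊗[K] V)) = ⊤ := by
  rw [eq_top_iff]
  rintro z -
  induction z with
  | zero => exact zero_mem _
  | add z w hz hw => exact add_mem hz hw
  | tmul a x =>
    obtain ⟨d, hd, hdx⟩ := hM x
    have h0 : algebraMap (𝓞 K) (v.adicCompletion K) d ≠ 0 := by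
      rw [IsScalarTower.algebraMap_apply (𝓞 K) K]
      simpa using hd
    have : a ⊗ₜ[K] x = ((algebraMap (𝓞 K) (v.adicCompletion K) d)⁻¹ * a) •
        ((1 : v.adicCompletion K) ⊗ₜ[K] (d • x)) := by
      rw [← algebraMap_mul_tmul, TensorProduct.smul_tmul', smul_eq_mul, mul_one]
      congr 1
      field_simp
    rw [this]
    exact Submodule.smul_mem _ _ (Submodule.subset_span (Submodule.subset_span ⟨_, hdx, rfl⟩))

/-- A local monic equation of degree `d` places `1 ⊗ a ^ d` in the completed lattice of the lower
powers. By descent some `s` outside `𝔭` satisfies a global equation with leading term `s a ^ d`, and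
then `s a` is integral. -/
theorem exists_isIntegral_smul_of_isIntegral_tmul {A : Type*} [CommRing A] [Algebra K A]
    [Algebra (𝓞 K) A] [IsScalarTower (𝓞 K) K A] {a : A}
    (ha : IsIntegral (v.adicCompletionIntegers K) ((1 : v.adicCompletion K) ⊗ₜ[K] a)) :
    ∃ s ∉ v.asIdeal, IsIntegral (𝓞 K) (s • a) := by
  obtain ⟨p, hp, hpa⟩ := ha
  let d := p.natDegree
  let M : Submodule (𝓞 K) A := Submodule.span (𝓞 K) (Set.range fun i : Fin d => a ^ (i : ℕ))
  have h1 : (1 : v.adicCompletion K) ⊗ₜ[K] (a ^ d) ∈ completedLattice v M := by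
    rw [← Polynomial.aeval_def, Polynomial.aeval_eq_sum_range, Finset.sum_range_succ,
      hp.coeff_natDegree, one_smul, Algebra.TensorProduct.tmul_pow, one_pow] at hpa
    rw [eq_neg_of_add_eq_zero_right hpa]
    refine neg_mem (sum_mem fun i hi => Submodule.smul_mem _ _ (Submodule.subset_span ?_))
    refine ⟨a ^ i, Submodule.subset_span ⟨⟨i, Finset.mem_range.mp hi⟩, rfl⟩, ?_⟩
    rw [Algebra.TensorProduct.tmul_pow, one_pow]
  obtain ⟨s, hs, hsM⟩ := mem_localizedLattice_of_one_tmul_mem v h1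
  refine ⟨s, hs, ?_⟩
  obtain ⟨c, hc⟩ := (Submodule.mem_span_range_iff_exists_fun _).mp hsM
  have hs0 : s ≠ 0 := by
    rintro rfl
    exact hs (zero_mem _)
  let q : Polynomial (𝓞 K) := ∑ i : Fin d, Polynomial.C (c i) * Polynomial.X ^ (i : ℕ)
  have hq : q.degree < d := Polynomial.degree_sum_fin_lt c
  have hlead : (Polynomial.C s * Polynomial.X ^ d - q).leadingCoeff = s := by
    rw [Polynomial.leadingCoeff_sub_of_degree_lt]
    · simp
    · rwa [Polynomial.degree_C_mul_X_pow d hs0]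
  have hz : Polynomial.aeval a (Polynomial.C s * Polynomial.X ^ d - q) = 0 := by
    simp only [q, map_sub, map_sum, map_mul, map_pow, Polynomial.aeval_C, Polynomial.aeval_X,
      ← Algebra.smul_def]
    rw [hc, sub_self]
  have := isIntegral_leadingCoeff_smul _ _ hz
  rwa [hlead] at this

end Completion

end HopfGalois
end

/-! ### Traces and integrality of coefficients in a group algebra -/

noncomputable section

/-- Over an algebraic closure the trace is the sum of the eigenvalues, each a root of the monic
polynomial `p`. -/
theorem LinearMap.isIntegral_trace {R k V : Type*} [CommRing R] [Field k] [Algebra R k]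
    [AddCommGroup V] [Module k V] [FiniteDimensional k V] {f : Module.End k V}
    {p : Polynomial R} (hp : p.Monic) (hf : Polynomial.aeval f (p.map (algebraMap R k)) = 0) :
    IsIntegral R (LinearMap.trace k V f) := by
  classical
  let b := Module.finBasis k V
  rw [LinearMap.trace_eq_matrix_trace k b]
  set A := LinearMap.toMatrix b b f with hA
  have hA0 : Polynomial.aeval A (p.map (algebraMap R k)) = 0 := by
    have h := congrArg (LinearMap.toMatrixAlgEquiv b) hf
    rw [← Polynomial.aeval_algHom_apply, map_zero] at h
    exact h
  have hinj : Function.Injective (algebraMap k (AlgebraicClosure k)) := RingHom.injective _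
  rw [← isIntegral_algebraMap_iff hinj]
  let ψ : Matrix (Fin (Module.finrank k V)) (Fin (Module.finrank k V)) k →ₐ[k]
      Matrix (Fin (Module.finrank k V)) (Fin (Module.finrank k V)) (AlgebraicClosure k) :=
    (Algebra.ofId k (AlgebraicClosure k)).mapMatrix
  have htr : algebraMap k (AlgebraicClosure k) A.trace = (ψ A).trace :=
    AddMonoidHom.map_trace (algebraMap k (AlgebraicClosure k)) A
  rw [htr, Matrix.trace_eq_sum_roots_charpoly]
  refine IsIntegral.multiset_sum fun μ hμ => ⟨p, hp, ?_⟩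
  have hspec : μ ∈ spectrum (AlgebraicClosure k) (ψ A) :=
    Matrix.mem_spectrum_iff_isRoot_charpoly.mpr (Polynomial.isRoot_of_mem_roots hμ)
  have h0 : Polynomial.aeval (ψ A) ((p.map (algebraMap R k)).map
      (algebraMap k (AlgebraicClosure k))) = 0 := by
    rw [Polynomial.aeval_map_algebraMap, Polynomial.aeval_algHom_apply, hA0, map_zero]
  have := spectrum.subset_polynomial_aeval (ψ A) ((p.map (algebraMap R k)).map
      (algebraMap k (AlgebraicClosure k))) ⟨μ, hspec, rfl⟩
  rw [h0] at this
  -- In dimension zero the matrix ring is trivial and has empty spectrum, so no eigenvalue could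
  -- have been given.
  have hne : Nontrivial (Matrix (Fin (Module.finrank k V)) (Fin (Module.finrank k V))
      (AlgebraicClosure k)) := by
    by_contra hn
    rw [not_nontrivial_iff_subsingleton] at hn
    simp [spectrum.of_subsingleton] at hspec
  rw [spectrum.zero_eq, Set.mem_singleton_iff, Polynomial.map_map,
    ← IsScalarTower.algebraMap_eq] at this
  rwa [← Polynomial.eval_map]

/-- In the basis `N` every diagonal entry of left multiplication by `z` is the coefficient at `1`.
-/
theorem MonoidAlgebra.trace_mulLeft {k N : Type*} [Field k] [Group N] [Finite N]
    (z : MonoidAlgebra k N) :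
    LinearMap.trace k _ (LinearMap.mulLeft k z) = Nat.card N * z.coeff 1 := by
  classical
  have := Fintype.ofFinite N
  rw [LinearMap.trace_eq_matrix_trace k (MonoidAlgebra.basis N k), Matrix.trace,
    Finset.sum_congr rfl (g := fun _ => z.coeff 1)]
  · simp [Nat.card_eq_fintype_card]
  · intro n _
    rw [Matrix.diag_apply, LinearMap.toMatrix_apply]
    simp [MonoidAlgebra.basis, MonoidAlgebra.coeff_mul_single_apply]

/-- The element `n⁻¹` has finite order, hence is integral, and so is `n⁻¹ z` by commutativity; its
trace is `|N|` times the coefficient of `z` at `n`. -/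
theorem MonoidAlgebra.isIntegral_card_mul_coeff {R k N : Type*} [CommRing R] [Field k]
    [Algebra R k] [CommGroup N] [Finite N] {z : MonoidAlgebra k N} (hz : IsIntegral R z) (n : N) :
    IsIntegral R (Nat.card N * z.coeff n) := by
  have h1 : IsIntegral R (MonoidAlgebra.single n⁻¹ (1 : k)) := by
    refine ⟨Polynomial.X ^ Nat.card N - 1, Polynomial.monic_X_pow_sub_C 1 Nat.card_pos.ne', ?_⟩
    simp [MonoidAlgebra.single_pow, MonoidAlgebra.one_def]
  obtain ⟨p, hp, hp0⟩ := h1.mul hz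
  have h2 := LinearMap.isIntegral_trace (f := LinearMap.mulLeft k
    (MonoidAlgebra.single n⁻¹ (1 : k) * z)) hp (by
      rw [Polynomial.aeval_map_algebraMap]
      have h3 := congrArg ((Algebra.lmul k (MonoidAlgebra k N)).restrictScalars R) hp0
      rw [← Polynomial.aeval_def, ← Polynomial.aeval_algHom_apply, map_zero] at h3
      exact h3)
  rw [MonoidAlgebra.trace_mulLeft] at h2
  simpa [MonoidAlgebra.coeff_single_mul_apply] using h2

/-! ### Galois descent for `E[N]` and its consequences for `N` and `H` -/

namespace HopfGalois

variable {K L E : Type*} [Field K] [Field L] [Field E]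
  [Algebra K L] [Algebra K E] [Algebra L E] [IsScalarTower K L E]

theorem cosetEmb_injective : Function.Injective (cosetEmb K L E) := by
  intro x y
  induction x using Quotient.inductionOn with | h a =>
  induction y using Quotient.inductionOn with | h b =>
  intro hab
  refine QuotientGroup.eq.mpr ?_
  refine (IntermediateField.mem_fixingSubgroup_iff _ _).mpr ?_
  rintro _ ⟨l, rfl⟩
  have h := DFunLike.congr_fun hab l
  change a (algebraMap L E l) = b (algebraMap L E l) at h
  change a⁻¹ (b (algebraMap L E l)) = algebraMap L E l
  rw [← h]
  exact a.symm_apply_apply _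

theorem card_cosetSpace [FiniteDimensional K E] [IsGalois K E] :
    Nat.card (CosetSpace K L E) = Module.finrank K L := by
  let φ : L →ₐ[K] E := IsScalarTower.toAlgHom K L E
  let e : L ≃ₐ[K] φ.fieldRange := AlgEquiv.ofInjectiveField φ
  rw [e.toLinearEquiv.finrank_eq]
  exact (IntermediateField.finrank_eq_fixingSubgroup_index E φ.fieldRange).symm

namespace RegularSubgroup

variable (S : RegularSubgroup K L E)

theorem inv_apply_injective [FiniteDimensional K E] (y : CosetSpace K L E) :
    Function.Injective fun n : S.N => (n⁻¹ : S.N).1 y := by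
  have : Finite (CosetSpace K L E) := Quotient.finite _
  refine (Function.Surjective.bijective_of_nat_card_le (fun x => ?_) S.card_eq.le).injective
  obtain ⟨n, hn, hnx⟩ := S.transitive y x
  exact ⟨⟨n, hn⟩⁻¹, by simpa using hnx⟩

/-- By regularity the embeddings attached to the cosets `n⁻¹ y` are distinct, so Dedekind's
independence of characters applies. -/
theorem eq_zero_of_actAt_eq_zero [FiniteDimensional K E] {z : MonoidAlgebra E S.N}
    (y : CosetSpace K L E) (h : ∀ x, S.actAt z y x = 0) : z = 0 := by
  have hli := (linearIndependent_monoidHom L E).comp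
    (fun n : S.N => (cosetEmb K L E ((n⁻¹ : S.N).1 y) : L →* E)) (by
      intro n m hnm
      refine S.inv_apply_injective y (cosetEmb_injective ?_)
      ext x
      exact DFunLike.congr_fun hnm x)
  rw [← MonoidAlgebra.coeff_eq_zero]
  refine linearIndependent_iff.mp hli z.coeff ?_
  ext x
  rw [Finsupp.linearCombination_apply, Finsupp.sum_apply']
  exact h x

theorem twist_single {F A : Type*} [CommRing F] [CommRing A] [Algebra F A] (g : E ≃ₐ[K] E)
    (σ : A →ₐ[F] A) (n : S.N) (a : A) :
    S.twist g σ (MonoidAlgebra.single n a) = MonoidAlgebra.single (S.conj g n) (σ a) := by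
  simp [twist]

theorem twist_smul (g : E ≃ₐ[K] E) (a : E) (z : MonoidAlgebra E S.N) :
    S.twist g (g : E →ₐ[K] E) (a • z) = g a • S.twist g (g : E →ₐ[K] E) z := by
  induction z using MonoidAlgebra.induction_linear with
  | zero => simp
  | add z w hz hw => rw [smul_add, map_add, map_add, smul_add, hz, hw]
  | single n c =>
    rw [MonoidAlgebra.smul_single, twist_single, twist_single, MonoidAlgebra.smul_single]
    simp

theorem conj_mul (g h : E ≃ₐ[K] E) (n : S.N) : S.conj (g * h) n = S.conj g (S.conj h n) := by
  ext; simp [conj, mul_assoc]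

theorem twist_twist (g h : E ≃ₐ[K] E) (z : MonoidAlgebra E S.N) :
    S.twist g (g : E →ₐ[K] E) (S.twist h (h : E →ₐ[K] E) z) =
      S.twist (g * h) ((g * h : E ≃ₐ[K] E) : E →ₐ[K] E) z := by
  induction z using MonoidAlgebra.induction_linear with
  | zero => simp
  | add z w hz hw => rw [map_add, map_add, map_add, hz, hw]
  | single n c =>
    rw [twist_single, twist_single, twist_single, conj_mul]
    rfl

theorem twist_one (z : MonoidAlgebra E S.N) :
    S.twist 1 ((1 : E ≃ₐ[K] E) : E →ₐ[K] E) z = z := by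
  induction z using MonoidAlgebra.induction_linear with
  | zero => simp
  | add z w hz hw => rw [map_add, hz, hw]
  | single n c =>
    rw [twist_single]
    congr 1
    ext; simp [conj]

/-- A linear form `f` vanishing on `H` kills every trace `∑ g(a) (g · z)`. As `a` varies,
independence of the automorphisms gives `f (g · z) = 0` for all `g`, in particular `f z = 0`. -/
theorem span_H [FiniteDimensional K E] :
    Submodule.span E (S.H : Set (MonoidAlgebra E S.N)) = ⊤ := by
  classical
  by_contra hne
  obtain ⟨f, hf0, hf⟩ := Submodule.exists_le_ker_of_lt_top _ (lt_top_iff_ne_top.mpr hne)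
  have := Fintype.ofFinite (E ≃ₐ[K] E)
  apply hf0
  refine LinearMap.ext fun z => ?_
  have hli := (linearIndependent_monoidHom E E).comp
    (fun g : E ≃ₐ[K] E => (g : E →* E)) (by
      intro g h hgh
      ext x
      exact DFunLike.congr_fun hgh x)
  have hz := Fintype.linearIndependent_iff.mp hli
    (fun g => f (S.twist g (g : E →ₐ[K] E) z)) (by
      ext a
      have hmem : ∑ g : E ≃ₐ[K] E, S.twist g (g : E →ₐ[K] E) (a • z) ∈ S.H := by
        intro h
        rw [map_sum]
        simp only [twist_twist]
        exact Fintype.sum_bijective _ (Group.mulLeft_bijective h) _ _ fun g => rfl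
      have h0 : f (∑ g : E ≃ₐ[K] E, S.twist g (g : E →ₐ[K] E) (a • z)) = 0 :=
        hf (Submodule.subset_span hmem)
      rw [map_sum] at h0
      simp only [twist_smul, map_smul, smul_eq_mul] at h0
      simpa [mul_comm] using h0)
  have := hz 1
  rwa [twist_one] at this

theorem mul_comm_of_H_comm [FiniteDimensional K E] (hcomm : ∀ a b : S.H, a * b = b * a)
    (n m : S.N) : n * m = m * n := by
  have key (z w : MonoidAlgebra E S.N) : z * w = w * z := by
    have hz : z ∈ Submodule.span E (S.H : Set (MonoidAlgebra E S.N)) :=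
      S.span_H ▸ Submodule.mem_top
    have hw : w ∈ Submodule.span E (S.H : Set (MonoidAlgebra E S.N)) :=
      S.span_H ▸ Submodule.mem_top
    induction hz, hw using Submodule.span_induction₂ with
    | mem_mem x y hx hy => exact congrArg Subtype.val (hcomm ⟨x, hx⟩ ⟨y, hy⟩)
    | zero_left y hy => simp
    | zero_right x hx => simp
    | add_left x y z hx hy hz h1 h2 => rw [add_mul, mul_add, h1, h2]
    | add_right x y z hx hy hz h1 h2 => rw [add_mul, mul_add, h1, h2]
    | smul_left r x y hx hy h => rw [smul_mul_assoc, mul_smul_comm, h]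
    | smul_right r x y hx hy h => rw [smul_mul_assoc, mul_smul_comm, h]
  have := key (MonoidAlgebra.single n 1) (MonoidAlgebra.single m 1)
  rw [MonoidAlgebra.single_mul_single, MonoidAlgebra.single_mul_single,
    MonoidAlgebra.single_left_inj (by simp)] at this
  exact this

instance finite_N [FiniteDimensional K E] : Finite S.N :=
  have : Finite (CosetSpace K L E) := Quotient.finite _
  inferInstance

instance finite_H [FiniteDimensional K E] : FiniteDimensional K S.H :=
  have : Module.Finite E (MonoidAlgebra E S.N) := 
    Module.Finite.of_basis (MonoidAlgebra.basis S.N E)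
  have : FiniteDimensional K (MonoidAlgebra E S.N) := Module.Finite.trans E _
  FiniteDimensional.finiteDimensional_submodule (Subalgebra.toSubmodule S.H)

/-- A `K`-basis of `H` spans `E[N]` over `E`. Only this inequality is needed to compare with
`[L:K]`. -/
theorem card_le_finrank_H [FiniteDimensional K E] : Nat.card S.N ≤ Module.finrank K S.H := by
  have := Fintype.ofFinite S.N
  let b := Module.finBasis K S.H
  have hspan : Submodule.span E (Set.range fun i => (b i : MonoidAlgebra E S.N)) = ⊤ := by
    rw [eq_top_iff, ← S.span_H, Submodule.span_le]
    intro z hz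
    have h1 := congrArg Subtype.val (b.sum_repr ⟨z, hz⟩)
    rw [SetLike.mem_coe, ← show _ = z from h1, AddSubmonoidClass.coe_finsetSum]
    refine Submodule.sum_mem _ fun i _ => ?_
    rw [SetLike.val_smul, ← algebraMap_smul E]
    exact Submodule.smul_mem _ _ (Submodule.subset_span ⟨i, rfl⟩)
  have h1 := finrank_range_le_card (R := E) fun i => (b i : MonoidAlgebra E S.N)
  rw [Set.finrank, hspan, finrank_top, Module.finrank_eq_card_basis (MonoidAlgebra.basis S.N E),
    Fintype.card_fin] at h1
  rwa [Nat.card_eq_fintype_card]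

end RegularSubgroup
end HopfGalois
end

/-! ### The associated order over `𝓞_K` -/

noncomputable section
namespace HopfGalois

namespace RegularSubgroup

theorem mem_integers_iff {K L : Type*} [Field K] [NumberField K] [Field L] [Algebra K L] {x : L} :
    x ∈ integers K L ↔ IsIntegral (𝓞 K) x := by
  have h : IsIntegral (𝓞 K) x ↔ IsIntegral ℤ x :=
    ⟨fun h => isIntegral_trans x h, fun h => h.tower_top⟩
  rw [h]
  constructor
  · rintro ⟨y, rfl⟩
    exact y.isIntegral_coe
  · intro hx
    exact ⟨⟨x, hx⟩, rfl⟩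

theorem exists_smul_mem_integers {K L : Type*} [Field K] [NumberField K] [Field L] [Algebra K L]
    [Algebra.IsAlgebraic K L] (x : L) : ∃ d : 𝓞 K, d ≠ 0 ∧ d • x ∈ integers K L := by
  have : IsAlgebraic (𝓞 K) x :=
    (IsFractionRing.isAlgebraic_iff (𝓞 K) K L).mpr (Algebra.IsAlgebraic.isAlgebraic x)
  obtain ⟨d, hd, hdx⟩ := this.exists_integral_multiple
  exact ⟨d, hd, mem_integers_iff.mpr hdx⟩

theorem integers_fg {K L : Type*} [Field K] [NumberField K] [Field L] [NumberField L]
    [Algebra K L] : (Subalgebra.toSubmodule (integers K L)).FG := by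
  have : FiniteDimensional K L := Module.Finite.of_restrictScalars_finite ℚ K L
  have : Module.Finite (𝓞 K) (𝓞 L) := IsIntegralClosure.finite (𝓞 K) K L (𝓞 L)
  have h := (Module.Finite.fg_top (R := 𝓞 K) (M := 𝓞 L)).map
    (IsScalarTower.toAlgHom (𝓞 K) (𝓞 L) L).toLinearMap
  rw [Submodule.map_top] at h
  exact h

variable {K L E : Type*} [Field K] [Field L] [Field E]
  [Algebra K L] [Algebra K E] [Algebra L E] [IsScalarTower K L E]
  [NumberField K] [NumberField E] [IsNormalClosure K L E] (S : RegularSubgroup K L E)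

theorem act_injective [FiniteDimensional K E] :
    Function.Injective S.act := by
  rw [injective_iff_map_eq_zero]
  intro h hh
  apply Subtype.ext
  refine S.eq_zero_of_actAt_eq_zero (baseCoset K L E) fun x => ?_
  rw [← algebraMap_actFun, show S.actFun h x = S.act h x from rfl, hh]
  simp

theorem mem_associatedOrder_of_isIntegral_coeff {h : S.H}
    (hc : ∀ n, IsIntegral (𝓞 K) ((h : MonoidAlgebra E S.N).coeff n)) :
    h ∈ S.associatedOrder := by
  have : IsScalarTower (𝓞 K) L E := IsScalarTower.of_algebraMap_eq fun x => by
    rw [IsScalarTower.algebraMap_apply (𝓞 K) K E, IsScalarTower.algebraMap_apply K L E,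
      ← IsScalarTower.algebraMap_apply (𝓞 K) K L]
  intro x hx
  rw [mem_integers_iff] at hx ⊢
  rw [← isIntegral_algebraMap_iff (algebraMap L E).injective]
  change IsIntegral (𝓞 K) (algebraMap L E (S.actFun h x))
  rw [algebraMap_actFun]
  exact IsIntegral.sum _ fun n _ => (hc n).mul (hx.map (cosetEmb K L E _))

omit [NumberField K] [NumberField E] [IsNormalClosure K L E] in
theorem isIntegral_card_mul_coeff [FiniteDimensional K E] (hcomm : ∀ a b : S.H, a * b = b * a)
    {h : S.H} (hh : IsIntegral (𝓞 K) h) (n : S.N) :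
    IsIntegral (𝓞 K) (Nat.card S.N * (h : MonoidAlgebra E S.N).coeff n) := by
  let _ : CommGroup S.N :=
    { (inferInstance : Group S.N) with mul_comm := S.mul_comm_of_H_comm hcomm }
  have h1 : IsIntegral (𝓞 K) (h : MonoidAlgebra E S.N) := hh.map S.H.val
  exact MonoidAlgebra.isIntegral_card_mul_coeff h1 n

theorem exists_smul_mem_associatedOrder [FiniteDimensional K E] (h : S.H) :
    ∃ d : 𝓞 K, d ≠ 0 ∧ algebraMap (𝓞 K) K d • h ∈ S.associatedOrder := by
  have := Fintype.ofFinite S.N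
  choose d hd hdn using fun n : S.N =>
    exists_smul_mem_integers (K := K) ((h : MonoidAlgebra E S.N).coeff n)
  refine ⟨∏ n, d n, Finset.prod_ne_zero_iff.mpr fun n _ => hd n,
    S.mem_associatedOrder_of_isIntegral_coeff fun n => ?_⟩
  obtain ⟨c, hc⟩ := Finset.dvd_prod_of_mem d (Finset.mem_univ n)
  have h1 := mem_integers_iff.mp ((integers K E).smul_mem (hdn n) c)
  rw [smul_smul, mul_comm, ← hc, ← algebraMap_smul K] at h1
  exact h1

/-- Faithfulness of the action embeds the order in a finite power of `𝓞_L` by evaluation on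
generators of `𝓞_L`; `𝓞_K` is Noetherian. -/
theorem associatedOrder_fg [FiniteDimensional K E] [NumberField L] :
    (Subalgebra.toSubmodule S.associatedOrder).FG := by
  have : Module.Finite (𝓞 K) (integers K L) := Module.Finite.iff_fg.mpr integers_fg
  obtain ⟨s, hs⟩ := integers_fg (K := K) (L := L)
  have hsint (x : s) : (x : L) ∈ integers K L := by
    have : (x : L) ∈ Subalgebra.toSubmodule (integers K L) := hs ▸ Submodule.subset_span x.2
    exact this
  let Ψ : S.associatedOrder →ₗ[𝓞 K] (s → integers K L) :=
    { toFun := fun h x => ⟨S.act h.1 x, h.2 x (hsint x)⟩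
      map_add' := fun h k => by ext x; simp
      map_smul' := fun c h => by
        ext x
        change S.act (algebraMap (𝓞 K) K c • h.1) x = c • S.act h.1 x
        rw [map_smul, LinearMap.smul_apply, algebraMap_smul] }
  have hΨ : Function.Injective Ψ := by
    rw [injective_iff_map_eq_zero]
    intro h hh
    apply Subtype.ext
    apply S.act_injective
    rw [ZeroMemClass.coe_zero, map_zero]
    have h1 : ∀ x ∈ Submodule.span (𝓞 K) (s : Set L), S.act h.1 x = 0 := by
      intro x hx
      induction hx using Submodule.span_induction with
      | mem x hx => exact congrArg Subtype.val (congrFun hh ⟨x, hx⟩)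
      | zero => simp
      | add x y _ _ h1 h2 => rw [map_add, h1, h2, add_zero]
      | smul c x _ h1 => rw [← algebraMap_smul K c x, map_smul, h1, smul_zero]
    ext x
    have : FiniteDimensional K L := Module.Finite.of_restrictScalars_finite ℚ K L
    obtain ⟨d, hd, hdx⟩ := exists_smul_mem_integers (K := K) x
    have h2 := h1 _ (by rw [hs]; exact hdx)
    rw [← algebraMap_smul K d x, map_smul] at h2
    exact (smul_eq_zero.mp h2).resolve_left (by simpa using hd)
  exact Module.Finite.iff_fg.mp (Module.Finite.of_injective Ψ hΨ)

/-! ### The completed embedding and its image -/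

variable (v : HeightOneSpectrum (𝓞 K))

omit [NumberField E] [IsNormalClosure K L E] in
theorem completedInclusion_tmul (a : v.adicCompletion K) (h : S.H) :
    S.completedInclusion v (a ⊗ₜ h) = a • MonoidAlgebra.mapAlgHom S.N
      (Algebra.TensorProduct.includeRight : E →ₐ[K] v.adicCompletion K ⊗[K] E) h := by
  rw [completedInclusion, Algebra.TensorProduct.lift_tmul, Algebra.ofId_apply,
    ← Algebra.smul_def]
  rfl

omit [NumberField E] [IsNormalClosure K L E] in
theorem coeff_completedInclusion_tmul (a : v.adicCompletion K) (h : S.H) (n : S.N) :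
    (S.completedInclusion v (a ⊗ₜ h)).coeff n = a ⊗ₜ (h : MonoidAlgebra E S.N).coeff n := by
  rw [completedInclusion_tmul, MonoidAlgebra.coeff_smul_apply]
  have : (MonoidAlgebra.mapAlgHom S.N (Algebra.TensorProduct.includeRight :
      E →ₐ[K] v.adicCompletion K ⊗[K] E) h).coeff n =
      1 ⊗ₜ[K] (h : MonoidAlgebra E S.N).coeff n := by
    simp
  rw [this, TensorProduct.smul_tmul', smul_eq_mul, mul_one]

omit [NumberField E] [IsNormalClosure K L E] in
theorem twist_mapAlgHom_includeRight (g : E ≃ₐ[K] E) (z : MonoidAlgebra E S.N) :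
    S.twist g (Algebra.TensorProduct.map
        (AlgHom.id (v.adicCompletion K) (v.adicCompletion K)) (g : E →ₐ[K] E))
      (MonoidAlgebra.mapAlgHom S.N
        (Algebra.TensorProduct.includeRight : E →ₐ[K] v.adicCompletion K ⊗[K] E) z) =
    MonoidAlgebra.mapAlgHom S.N
        (Algebra.TensorProduct.includeRight : E →ₐ[K] v.adicCompletion K ⊗[K] E)
      (S.twist g (g : E →ₐ[K] E) z) := by
  induction z using MonoidAlgebra.induction_linear with
  | zero => simp
  | add z w hz hw => simp only [map_add, hz, hw]
  | single n c => simp [twist_single]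

omit [NumberField E] [IsNormalClosure K L E] in
theorem completedInclusion_mem_completedFixedPoints (z : v.adicCompletion K ⊗[K] S.H) :
    S.completedInclusion v z ∈ S.completedFixedPoints v := by
  induction z with
  | zero => rw [map_zero]; exact zero_mem _
  | add z w hz hw => rw [map_add]; exact add_mem hz hw
  | tmul a h =>
    rw [completedInclusion_tmul]
    refine Subalgebra.smul_mem _ ?_ a
    intro g
    rw [twist_mapAlgHom_includeRight]
    congr 1
    exact h.2 g

-- Taking fixed points commutes with the scalar extension: coordinates along a `K`-basis of `K_𝔭`
-- are compatible with `G`, so each coordinate of a fixed element is a fixed element of `E[N]`.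
omit [IsNormalClosure K L E] in
theorem exists_completedInclusion_eq [FiniteDimensional K E]
    {z : MonoidAlgebra (v.adicCompletion K ⊗[K] E) S.N} (hz : z ∈ S.completedFixedPoints v) :
    ∃ h, S.completedInclusion v h = z := by
  classical
  have := Fintype.ofFinite S.N
  let b := Module.Basis.ofVectorSpace K (v.adicCompletion K)
  let e := TensorProduct.equivFinsuppOfBasisLeft (N := E) b
  let π (j) (w : MonoidAlgebra (v.adicCompletion K ⊗[K] E) S.N) : MonoidAlgebra E S.N :=
    ∑ n, MonoidAlgebra.single n (e (w.coeff n) j)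
  have hπadd (j) (w w') : π j (w + w') = π j w + π j w' := by
    simp [π, Finset.sum_add_distrib, MonoidAlgebra.single_add]
  have hπsingle (j) (n) (t : v.adicCompletion K ⊗[K] E) :
      π j (MonoidAlgebra.single n t) = MonoidAlgebra.single n (e t j) := by
    simp only [π]
    rw [Finset.sum_eq_single n]
    · simp
    · intro m _ hm
      simp [Finsupp.single_eq_of_ne hm]
    · simp
  have hπcoeff (j) (w) (n) : (π j w).coeff n = e (w.coeff n) j := by
    simp [π, MonoidAlgebra.coeff_sum, Finsupp.single_apply]
  have heg (g : E ≃ₐ[K] E) (t : v.adicCompletion K ⊗[K] E) (j) :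
      e (Algebra.TensorProduct.map (AlgHom.id (v.adicCompletion K) (v.adicCompletion K))
        (g : E →ₐ[K] E) t) j = g (e t j) := by
    have hsmul (c : K) (x : E) : g (c • x) = c • g x := by
      rw [Algebra.smul_def, map_mul, AlgEquiv.commutes, Algebra.smul_def]
    induction t with
    | zero => simp
    | add t t' h h' => simp [h, h']
    | tmul a x => simp [e, hsmul]
  have hπtwist (g : E ≃ₐ[K] E) (j) (w) :
      π j (S.twist g (Algebra.TensorProduct.map
        (AlgHom.id (v.adicCompletion K) (v.adicCompletion K)) (g : E →ₐ[K] E)) w) =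
      S.twist g (g : E →ₐ[K] E) (π j w) := by
    induction w using MonoidAlgebra.induction_linear with
    | zero => simp [π]
    | add w w' h h' => rw [map_add, hπadd, hπadd, map_add, h, h']
    | single n t => rw [twist_single, hπsingle, hπsingle, twist_single, heg]; rfl
  have hπmem (j) : π j z ∈ S.H := fun g => by rw [← hπtwist, hz g]
  -- The `K`-basis of `K_𝔭` may be infinite, but only these indices occur in the coefficients of
  -- `z`.
  let J := Finset.univ.biUnion fun n : S.N => (e (z.coeff n)).support
  refine ⟨∑ j ∈ J, b j ⊗ₜ ⟨π j z, hπmem j⟩, ?_⟩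
  ext n
  rw [map_sum, MonoidAlgebra.coeff_sum, Finsupp.finsetSum_apply]
  simp only [coeff_completedInclusion_tmul, hπcoeff]
  have h1 : z.coeff n = (e (z.coeff n)).sum fun j x => b j ⊗ₜ[K] x := by
    rw [← TensorProduct.equivFinsuppOfBasisLeft_symm_apply]
    exact (e.symm_apply_apply _).symm
  conv_rhs => rw [h1]
  exact (Finset.sum_subset (Finset.subset_biUnion_of_mem (fun n => (e (z.coeff n)).support)
    (Finset.mem_univ n)) fun j _ hj => by
      rw [Finsupp.notMem_support_iff.mp hj, TensorProduct.tmul_zero]).symm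

end RegularSubgroup
end HopfGalois
end

/-! ### The completed associated order: integral coefficients, maximality and freeness -/

noncomputable section
namespace HopfGalois

theorem natCast_notMem_of_not_dvd {R : Type*} [CommRing R] {I : Ideal R} (hI : I ≠ ⊤) {p n : ℕ}
    (hp : p.Prime) (hpI : (p : R) ∈ I) (hn : ¬ p ∣ n) : (n : R) ∉ I := by
  intro hnI
  apply hI
  rw [Ideal.eq_top_iff_one]
  obtain ⟨a, b, hab⟩ := (Nat.isCoprime_iff_coprime.mpr ((Nat.Prime.coprime_iff_not_dvd hp).mpr hn))
  have h1 : (a : R) * p + b * n = 1 := by exact_mod_cast congrArg (Int.cast : ℤ → R) hab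
  rw [← h1]
  exact add_mem (I.mul_mem_left _ hpI) (I.mul_mem_left _ hnI)

theorem exists_forall_smul_mem {K : Type*} [Field K] [NumberField K]
    (v : HeightOneSpectrum (𝓞 K)) {V : Type*} [AddCommGroup V] [Module K V] [Module (𝓞 K) V]
    [IsScalarTower (𝓞 K) K V] {ι : Type*} [Finite ι] {M : Submodule (𝓞 K) V} {x : ι → V}
    (hx : ∀ i, x i ∈ localizedLattice v M) : ∃ s ∉ v.asIdeal, ∀ i, s • x i ∈ M := by
  have := Fintype.ofFinite ι
  choose s hs hsx using hx
  refine ⟨∏ i, s i, fun h => ?_, fun i => ?_⟩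
  · obtain ⟨i, -, hi⟩ := (Ideal.IsPrime.prod_mem_iff (hp := v.isPrime)).mp h
    exact hs i hi
  · obtain ⟨c, hc⟩ := Finset.dvd_prod_of_mem s (Finset.mem_univ i)
    rw [hc, mul_comm, mul_smul]
    exact M.smul_mem c (hsx i)

section CompletedOrder

variable {K : Type*} [Field K] [NumberField K] (v : HeightOneSpectrum (𝓞 K))
  {A : Type*} [Ring A] [Algebra K A] [Algebra (𝓞 K) A] [IsScalarTower (𝓞 K) K A]
  {Λ : Subalgebra (𝓞 K) A}

theorem isOrder_completedOrder (hfg : (Subalgebra.toSubmodule Λ).FG)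
    (h : ∀ x : A, ∃ d : 𝓞 K, d ≠ 0 ∧ algebraMap (𝓞 K) K d • x ∈ Λ) :
    IsOrder (v.adicCompletion K) (completedOrder v Λ) :=
  ⟨completedLattice_fg v hfg, span_completedLattice_eq_top v
    (M := Subalgebra.toSubmodule Λ)
    (by simpa only [algebraMap_smul, Subalgebra.mem_toSubmodule] using h)⟩

theorem exists_sub_one_tmul_mem_completedOrder
    (h : ∀ x : A, ∃ d : 𝓞 K, d ≠ 0 ∧ algebraMap (𝓞 K) K d • x ∈ Λ)
    (z : v.adicCompletion K ⊗[K] A) : ∃ x : A, z - 1 ⊗ₜ x ∈ completedOrder v Λ :=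
  exists_sub_one_tmul_mem_completedLattice v (M := Subalgebra.toSubmodule Λ)
    (by simpa only [algebraMap_smul, Subalgebra.mem_toSubmodule] using h) z

end CompletedOrder

namespace RegularSubgroup

variable {K L E : Type*} [Field K] [Field L] [Field E]
  [Algebra K L] [Algebra K E] [Algebra L E] [IsScalarTower K L E]
  [NumberField K] [NumberField L] [NumberField E] [IsNormalClosure K L E]
  (S : RegularSubgroup K L E) (v : HeightOneSpectrum (𝓞 K))

theorem isOrder_completedAssociatedOrder [FiniteDimensional K E] :
    IsOrder (v.adicCompletion K) (S.completedAssociatedOrder v) :=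
  isOrder_completedOrder v S.associatedOrder_fg S.exists_smul_mem_associatedOrder

omit [NumberField L] in
theorem one_tmul_mem_of_coeff_mem [FiniteDimensional K E] {h : S.H}
    (hh : ∀ n, (h : MonoidAlgebra E S.N).coeff n ∈
      localizedLattice v (Subalgebra.toSubmodule (integers K E))) :
    1 ⊗ₜ[K] h ∈ S.completedAssociatedOrder v := by
  obtain ⟨s, hs, hsn⟩ := exists_forall_smul_mem v hh
  refine one_tmul_mem_completedLattice v ⟨s, hs, ?_⟩
  refine S.mem_associatedOrder_of_isIntegral_coeff fun n => ?_
  exact mem_integers_iff.mp (hsn n)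

-- This is where `p ∤ [L:K]` enters: the factor `|N|` from the trace argument lies outside `𝔭`, so
-- it can be absorbed into the localising multiplier.
omit [NumberField L] [NumberField E] [IsNormalClosure K L E] in
theorem coeff_mem_of_isIntegral [FiniteDimensional K E] (hcomm : ∀ a b : S.H, a * b = b * a)
    (hcard : (Nat.card S.N : 𝓞 K) ∉ v.asIdeal) {s : 𝓞 K} (hs : s ∉ v.asIdeal) {h : S.H}
    (hh : IsIntegral (𝓞 K) (algebraMap (𝓞 K) K s • h)) (n : S.N) :
    (h : MonoidAlgebra E S.N).coeff n ∈
      localizedLattice v (Subalgebra.toSubmodule (integers K E)) := by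
  refine ⟨Nat.card S.N * s, v.isPrime.mul_notMem hcard hs, mem_integers_iff.mpr ?_⟩
  have h1 := S.isIntegral_card_mul_coeff hcomm hh n
  have h2 : ((Nat.card S.N : 𝓞 K) * s) • (h : MonoidAlgebra E S.N).coeff n =
      Nat.card S.N * ((algebraMap (𝓞 K) K s • h : S.H) : MonoidAlgebra E S.N).coeff n := by
    rw [mul_smul, Nat.cast_smul_eq_nsmul, nsmul_eq_mul, ← algebraMap_smul K s]
    rfl
  rw [h2]
  exact h1

theorem coeff_completedInclusion_mem [FiniteDimensional K E]
    (hcomm : ∀ a b : S.H, a * b = b * a) (hcard : (Nat.card S.N : 𝓞 K) ∉ v.asIdeal)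
    {z : v.adicCompletion K ⊗[K] S.H} (hz : z ∈ S.completedAssociatedOrder v) (n : S.N) :
    (S.completedInclusion v z).coeff n ∈ completedIntegers v E := by
  change z ∈ completedLattice v _ at hz
  induction hz using Submodule.span_induction with
  | mem z hz =>
    obtain ⟨h, hh, rfl⟩ := hz
    rw [coeff_completedInclusion_tmul]
    have hint : IsIntegral (𝓞 K) h :=
      IsIntegral.of_mem_of_fg S.associatedOrder S.associatedOrder_fg h hh
    refine one_tmul_mem_completedLattice v (S.coeff_mem_of_isIntegral v hcomm hcard
      v.isPrime.one_notMem ?_ n)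
    rwa [map_one, one_smul]
  | zero => simp
  | add z w _ _ hz hw => rw [map_add]; exact add_mem hz hw
  | smul r z _ hz =>
    rw [← algebraMap_smul (v.adicCompletion K) r z, map_smul, MonoidAlgebra.coeff_smul_apply,
      algebraMap_smul]
    exact Subalgebra.smul_mem _ hz r

theorem image_completedInclusion [FiniteDimensional K E]
    (hcomm : ∀ a b : S.H, a * b = b * a) (hcard : (Nat.card S.N : 𝓞 K) ∉ v.asIdeal) :
    S.completedInclusion v '' (S.completedAssociatedOrder v) =
      S.completedIntegralFixedPoints v := by
  ext z
  constructor
  · rintro ⟨z, hz, rfl⟩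
    exact ⟨S.completedInclusion_mem_completedFixedPoints v z,
      S.coeff_completedInclusion_mem v hcomm hcard hz⟩
  · rintro ⟨hz, hzn⟩
    obtain ⟨z, rfl⟩ := S.exists_completedInclusion_eq v hz
    refine ⟨z, ?_, rfl⟩
    -- Modulo the completed order `z` is some `1 ⊗ h`, and the part removed has integral
    -- coefficients by the inclusion already known; only the coefficients of `h` remain to be
    -- descended.
    obtain ⟨h, hh⟩ := exists_sub_one_tmul_mem_completedOrder v S.exists_smul_mem_associatedOrder z
    rw [← sub_add_cancel z (1 ⊗ₜ h)]
    refine add_mem hh (S.one_tmul_mem_of_coeff_mem v fun n =>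
      mem_localizedLattice_of_one_tmul_mem v ?_)
    have h1 := sub_mem (hzn n) (S.coeff_completedInclusion_mem v hcomm hcard hh n)
    rw [map_sub, MonoidAlgebra.coeff_sub, Finsupp.sub_apply, sub_sub_cancel,
      coeff_completedInclusion_tmul] at h1
    exact h1

omit [NumberField L] [NumberField E] [IsNormalClosure K L E] in
theorem completed_mul_comm (hcomm : ∀ a b : S.H, a * b = b * a)
    (z w : v.adicCompletion K ⊗[K] S.H) : z * w = w * z := by
  induction z with
  | zero => simp
  | add z z' h h' => rw [add_mul, mul_add, h, h']
  | tmul a x =>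
    induction w with
    | zero => simp
    | add w w' h h' => rw [add_mul, mul_add, h, h']
    | tmul b y =>
      rw [Algebra.TensorProduct.tmul_mul_tmul, Algebra.TensorProduct.tmul_mul_tmul, mul_comm,
        hcomm]

theorem mem_completedAssociatedOrder_of_isIntegral [FiniteDimensional K E]
    (hcomm : ∀ a b : S.H, a * b = b * a) (hcard : (Nat.card S.N : 𝓞 K) ∉ v.asIdeal)
    {z : v.adicCompletion K ⊗[K] S.H} (hz : IsIntegral (v.adicCompletionIntegers K) z) :
    z ∈ S.completedAssociatedOrder v := by
  let _ : CommRing S.H := { (inferInstance : Ring S.H) with mul_comm := hcomm }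
  obtain ⟨h, hh⟩ := exists_sub_one_tmul_mem_completedOrder v S.exists_smul_mem_associatedOrder z
  have h1 : IsIntegral (v.adicCompletionIntegers K) (z - 1 ⊗ₜ h) :=
    IsIntegral.of_mem_of_fg _ (S.isOrder_completedAssociatedOrder v).1 _ hh
  have h2 : IsIntegral (v.adicCompletionIntegers K) ((1 : v.adicCompletion K) ⊗ₜ[K] h) := by
    rw [← sub_sub_cancel z ((1 : v.adicCompletion K) ⊗ₜ[K] h)]
    exact IsIntegral.sub hz h1
  obtain ⟨s, hs, hsh⟩ := exists_isIntegral_smul_of_isIntegral_tmul v h2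
  rw [← sub_add_cancel z (1 ⊗ₜ h)]
  exact add_mem hh (S.one_tmul_mem_of_coeff_mem v
    (S.coeff_mem_of_isIntegral v hcomm hcard hs hsh))

theorem isUniqueMaximalOrder_completedAssociatedOrder [FiniteDimensional K E]
    (hcomm : ∀ a b : S.H, a * b = b * a) (hcard : (Nat.card S.N : 𝓞 K) ∉ v.asIdeal) :
    IsUniqueMaximalOrder (v.adicCompletion K) (S.completedAssociatedOrder v) := by
  have hle (Λ : Subalgebra (v.adicCompletionIntegers K) (v.adicCompletion K ⊗[K] S.H))
      (hΛ : IsOrder (v.adicCompletion K) Λ) : Λ ≤ S.completedAssociatedOrder v := fun z hz =>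
    S.mem_completedAssociatedOrder_of_isIntegral v hcomm hcard
      (IsIntegral.of_mem_of_fg Λ hΛ.1 z hz)
  have hM := S.isOrder_completedAssociatedOrder v
  intro Λ
  constructor
  · intro hΛ
    exact le_antisymm (hle Λ hΛ.prop) (hΛ.le_of_ge hM (hle Λ hΛ.prop))
  · rintro rfl
    exact ⟨hM, fun Λ hΛ _ => hle Λ hΛ⟩

-- Along a `K`-basis of `K_𝔭` the action on `1 ⊗ x` splits into actions of elements of `H` on `x`,
-- so faithfulness is inherited from `L`.
omit [NumberField L] in
theorem completedAction_injective [FiniteDimensional K E] :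
    Function.Injective (completedAction v S.act) := by
  classical
  let b := Module.Basis.ofVectorSpace K (v.adicCompletion K)
  let eH := TensorProduct.equivFinsuppOfBasisLeft (N := S.H) b
  let eL := TensorProduct.equivFinsuppOfBasisLeft (N := L) b
  have key (z : v.adicCompletion K ⊗[K] S.H) (x : L) (j) :
      eL (completedAction v S.act z (1 ⊗ₜ x)) j = S.act (eH z j) x := by
    induction z with
    | zero => simp
    | add z w hz hw => simp [hz, hw]
    | tmul a h =>
      rw [completedAction_tmul, mul_one]
      simp only [eL, eH]
      rw [TensorProduct.equivFinsuppOfBasisLeft_apply_tmul_apply,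
        TensorProduct.equivFinsuppOfBasisLeft_apply_tmul_apply, map_smul, LinearMap.smul_apply]
  rw [injective_iff_map_eq_zero]
  intro z hz
  apply eH.injective
  rw [map_zero]
  ext1 j
  apply S.act_injective
  rw [Finsupp.zero_apply, map_zero]
  ext x
  rw [← key, hz]
  simp

theorem free_completedIntegers [FiniteDimensional K E] [IsGalois K E]
    (hcomm : ∀ a b : S.H, a * b = b * a) (hcard : (Nat.card S.N : 𝓞 K) ∉ v.asIdeal) :
    Module.Free (S.completedAssociatedOrder v) (completedIntegers v L) := by
  let _ : CommRing (v.adicCompletion K ⊗[K] S.H) :=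
    { (inferInstance : Ring (v.adicCompletion K ⊗[K] S.H)) with
      mul_comm := S.completed_mul_comm v hcomm }
  have : FiniteDimensional K L := Module.Finite.of_restrictScalars_finite ℚ K L
  have : CharZero (v.adicCompletion K) :=
    charZero_of_injective_algebraMap (algebraMap K (v.adicCompletion K)).injective
  have hint := @mem_completedAssociatedOrder_of_isIntegral K L E _ _ _ _ _ _ _ _ _ _ _ S v _
    hcomm hcard
  have : IsReduced (v.adicCompletion K ⊗[K] S.H) :=
    isReduced_of_fg_of_isIntegral_mem (F := v.adicCompletion K) _
      (S.isOrder_completedAssociatedOrder v).1 fun a ha => hint ha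
  obtain ⟨w, hw, hwV⟩ := exists_generator_of_isIntegral_stable
    (O := v.adicCompletionIntegers K) (completedAction v S.act) (S.completedAction_injective v)
    (by
      rw [Module.finrank_baseChange, Module.finrank_baseChange, ← card_cosetSpace (E := E),
        ← S.card_eq]
      exact S.card_le_finrank_H)
    (Subalgebra.toSubmodule (completedIntegers v L)) (completedLattice_fg v integers_fg)
    (span_completedLattice_eq_top v exists_smul_mem_integers)
    (fun a ha x hx => S.completedAction_mem v (hint ha) hx)
  have hwmem : w ∈ completedIntegers v L := by
    have h1 := (hwV 1).mpr isIntegral_one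
    rwa [map_one] at h1
  refine Module.Free.of_equiv (LinearEquiv.ofBijective (LinearMap.toSpanSingleton
    (S.completedAssociatedOrder v) (completedIntegers v L) ⟨w, hwmem⟩) ⟨?_, ?_⟩)
  · intro a b hab
    exact Subtype.ext (hw.1 (congrArg Subtype.val hab))
  · intro x
    obtain ⟨a, ha⟩ := hw.2 x.1
    replace ha : completedAction v S.act a w = x.1 := ha
    -- The multiplier carrying `w` to a point of the lattice is integral by the choice of `w`, hence
    -- lies in the completed associated order.
    exact ⟨⟨a, hint ((hwV a).mp (ha.symm ▸ x.2))⟩, Subtype.ext ha⟩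

end RegularSubgroup
end HopfGalois

end

theorem mainTheorem5 {K L E : Type*} [Field K] [NumberField K] [Field L] [NumberField L]
    [Field E] [NumberField E] [Algebra K L] [Algebra K E] [Algebra L E] [IsScalarTower K L E]
    [IsNormalClosure K L E]
    (S : HopfGalois.RegularSubgroup K L E)
    (hcomm : ∀ a b : S.H, a * b = b * a)
    (𝔭 : IsDedekindDomain.HeightOneSpectrum (𝓞 K)) (p : ℕ) (hp : p.Prime)
    (h𝔭 : (p : 𝓞 K) ∈ 𝔭.asIdeal) (hdeg : ¬ p ∣ Module.finrank K L) :
    S.completedInclusion 𝔭 '' (S.completedAssociatedOrder 𝔭) =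
        S.completedIntegralFixedPoints 𝔭 ∧
      HopfGalois.IsUniqueMaximalOrder (𝔭.adicCompletion K) (S.completedAssociatedOrder 𝔭) ∧
      Module.Free (S.completedAssociatedOrder 𝔭)
        (HopfGalois.RegularSubgroup.completedIntegers 𝔭 L) := by
  have : Normal K E := IsNormalClosure.normal (F := K) (K := L) (L := E)
  have : IsGalois K E := {}
  have : FiniteDimensional K E := Module.Finite.of_restrictScalars_finite ℚ K E
  have hcard : (Nat.card S.N : 𝓞 K) ∉ 𝔭.asIdeal := by
    rw [S.card_eq, HopfGalois.card_cosetSpace]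
    exact HopfGalois.natCast_notMem_of_not_dvd 𝔭.isPrime.ne_top hp h𝔭 hdeg
  exact ⟨S.image_completedInclusion 𝔭 hcomm hcard,
    S.isUniqueMaximalOrder_completedAssociatedOrder 𝔭 hcomm hcard,
    S.free_completedIntegers 𝔭 hcomm hcard⟩
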